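/- Let $T$ be a tree on a vertex set $V$ with $|V| = n \ge 3$, with positive real edge weights. Colour a 3-element subset of $V$ red if one of its points lies on the shortest (in $T$: the unique) path between the other two, and blue otherwise. For distinct $u, v \in V$ let the red line of $u,v$ be $R(uv) = \{u,v\} \cup \{p : \{u,v,p\} \text{ is a red triple}\}$ and the blue line be $B(uv) = \{u,v\} \cup \{p : \{u,v,p\} \text{ is a blue triple}\}$. Let $m$ be the number of distinct sets of the form $R(uv)$ plus the number of distinct sets of the form $B(uv)$ (a set that is both a red and a blue line is counted twice). Then $$m \ge \begin{cases} \left\lfloor \frac{n^2}{4} + n + 1 \right\rfloor & \text{if } n \ge 6, \\ \binom{n}{2} + 1 & \text{if } n \le 6 \end{cases}$$ (for $n = 6$ the two bounds coincide). Equality holds if and only if (1) $n \le 6$ and $T$ is a path, or (2) $n \ge 6$ and $T$ is isomorphic to $S(a^*, n - a^*)$, where $a^* = (n-1)/2$ if $n$ is odd, and $a^* = n/2 - 1$ or $a^* = n/2$ if $n$ is even. Here $S(p,q)$ denotes the tree on $p + q$ vertices that consists of a path on $q$ vertices and $p$ further leaves, all attached to the same end of the path. -/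

import Mathlib

/-- The two colours of a bi-coloured system. -/
inductive Colour where
  | red
  | blue

/-- A bi-coloured system on the point set `V`: a colouring of all 3-element subsets of `V`. -/
structure BicolouredSystem (V : Type*) where
  colour : {s : Set V // s.ncard = 3} → Colour

namespace BicolouredSystem

variable {V : Type*}

/-- The line of colour `κ` generated by `u` and `v`: the points `u`, `v`, and all `p` such that
`{u, v, p}` is a triple of colour `κ`. -/
def line (S : BicolouredSystem V) (κ : Colour) (u v : V) : Set V :=
  {u, v} ∪ {p | ∃ h : ({u, v, p} : Set V).ncard = 3, S.colour ⟨{u, v, p}, h⟩ = κ}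

/-- The set of all lines of colour `κ`, generated by pairs of distinct points. -/
def lines (S : BicolouredSystem V) (κ : Colour) : Set (Set V) :=
  {L | ∃ u v : V, u ≠ v ∧ L = S.line κ u v}

/-- The number of distinct red lines plus the number of distinct blue lines (a set that is both a
red line and a blue line is counted twice). -/
noncomputable def numLines (S : BicolouredSystem V) : ℕ :=
  (S.lines Colour.red).ncard + (S.lines Colour.blue).ncard

end BicolouredSystem

namespace SimpleGraph

variable {V : Type*}

/-- The length of a walk with respect to edge weights `w`. -/
def Walk.weight {G : SimpleGraph V} (w : Sym2 V → ℝ) {x y : V} (p : G.Walk x y) : ℝ :=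
  (p.edges.map w).sum

/-- `p` is a shortest path between its ends in the graph with edge weights `w`. -/
def Walk.IsShortestPath {G : SimpleGraph V} (w : Sym2 V → ℝ) {x y : V} (p : G.Walk x y) : Prop :=
  p.IsPath ∧ ∀ q : G.Walk x y, q.IsPath → p.weight w ≤ q.weight w

/-- One of the points of the triple `s` lies on a shortest path between the other two. -/
def IsCollinearTriple (G : SimpleGraph V) (w : Sym2 V → ℝ) (s : Set V) : Prop :=
  ∃ x y z : V, s = {x, y, z} ∧ ∃ p : G.Walk x z, p.IsShortestPath w ∧ y ∈ p.support

open Classical in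
/-- The bi-coloured system derived from a graph with edge weights `w` (only the values of `w` on
the edges matter): a triple is red iff one of its points lies on a shortest path between the
other two. -/
noncomputable def derivedSystem (G : SimpleGraph V) (w : Sym2 V → ℝ) : BicolouredSystem V where
  colour s := if G.IsCollinearTriple w s.1 then Colour.red else Colour.blue

/-- The tree `S(p, q)`: a path on the `q` vertices `inr 0, …, inr (q - 1)`, with `p` leaves
`inl i` attached to its end `inr 0`. -/
def broom (p q : ℕ) : SimpleGraph (Fin p ⊕ Fin q) :=
  SimpleGraph.fromRel fun
    | Sum.inl _, Sum.inr j => j.val = 0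
    | Sum.inr i, Sum.inr j => i.val + 1 = j.val
    | _, _ => False

/-- `G` is a path on `n` vertices. -/
def IsPathOn (G : SimpleGraph V) (n : ℕ) : Prop :=
  Nonempty (G ≃g SimpleGraph.pathGraph n)

/-- `G` is `S(a, n - a)` with `a = (n - 1) / 2` if `n` is odd, and `a = n / 2 - 1` or `a = n / 2`
if `n` is even. -/
def IsBalancedBroom (G : SimpleGraph V) (n : ℕ) : Prop :=
  ∃ a : ℕ, ((Odd n ∧ a = (n - 1) / 2) ∨ (Even n ∧ (a = n / 2 - 1 ∨ a = n / 2))) ∧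
    Nonempty (G ≃g SimpleGraph.broom a (n - a))

end SimpleGraph

/-! In a tree the path between two points is unique, so the weights drop out: a triple is red iff
its points are collinear in the graph metric. Call two leaves twins if they have the same neighbour.
Let s be the number of vertices left over when one representative per twin class is removed, k the
number of nontrivial classes, and l the number of leaves.

Blue lines nearly determine their generators: by `IsTree.isTwin_of_blueSet_eq`, equal blue lines
have the same generators up to twins. Hence `IsTree.ncard_blue_lines` counts them exactly, as C(n -
s, 2) + s + k. For red lines a lower bound is enough: no three leaves are collinear, so for l ≥ 3
the pairs of leaves give C(l, 2) lines, none of which is the whole set, and an edge generates the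
whole set (`IsTree.le_ncard_red_lines`).

Always s + k ≤ l. If k = 0 and the tree is not a path, the sum exceeds the C(n, 2) + 1 lines of a
path. A star also exceeds it. Otherwise l ≥ s + 2, and the sum is at least `broomLines n s`, with
equality only for k = 1 and l = s + 2, that is, when all leaves but one hang on one vertex: a broom.
Completing the square in s gives 4 · `broomLines n s` = n² + 4n + 3 + (n - 2s - 3)², whose minimum
is the stated bound and whose minimisers are the balanced brooms. -/

namespace SimpleGraph

variable {V : Type*} {T : SimpleGraph V}

/-! ### Betweenness and collinearity in the metric of a tree. -/

/-- `p` lies between `u` and `v` in the graph metric. -/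
def IsBetween (T : SimpleGraph V) (u p v : V) : Prop :=
  T.dist u p + T.dist p v = T.dist u v

/-- One of `u`, `v`, `p` lies between the other two in the graph metric. -/
def IsCollinear (T : SimpleGraph V) (u v p : V) : Prop :=
  T.IsBetween u p v ∨ T.IsBetween p u v ∨ T.IsBetween u v p

/-- `x` is the only neighbour of `l`. -/
def IsLeafAt (T : SimpleGraph V) (l x : V) : Prop :=
  T.Adj l x ∧ ∀ y, T.Adj l y → y = x

/-- `l` has exactly one neighbour. -/
def IsLeaf (T : SimpleGraph V) (l : V) : Prop :=
  ∃ x, T.IsLeafAt l x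

lemma IsTree.length_eq_dist (hT : T.IsTree) {u v : V} {p : T.Walk u v} (hp : p.IsPath) :
    p.length = T.dist u v := by
  obtain ⟨q, hq, hl⟩ := hT.connected.exists_path_of_dist u v
  rw [(hT.existsUnique_path u v).unique hp hq, hl]

/-- If the distances add up, joining geodesics from `u` to `x` and from `x` to `v` gives a walk of
length the distance, hence a path, and there is only one. -/
lemma IsTree.mem_support_iff (hT : T.IsTree) {u v x : V} {p : T.Walk u v} (hp : p.IsPath) :
    x ∈ p.support ↔ T.IsBetween u x v := by
  classical
  constructor
  · intro h
    have h1 := hT.length_eq_dist (hp.takeUntil h)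
    have h2 := hT.length_eq_dist (hp.dropUntil h)
    have h3 := hT.length_eq_dist hp
    have h4 := congrArg Walk.length (p.take_spec h)
    rw [Walk.length_append] at h4
    unfold IsBetween
    omega
  · intro h
    obtain ⟨a, -, ha⟩ := hT.connected.exists_path_of_dist u x
    obtain ⟨b, -, hb⟩ := hT.connected.exists_path_of_dist x v
    have hab : (a.append b).IsPath := by
      apply Walk.isPath_of_length_eq_dist
      rw [Walk.length_append, ha, hb]
      exact h
    rw [(hT.existsUnique_path u v).unique hp hab, Walk.mem_support_append_iff]
    exact Or.inl a.end_mem_support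

lemma IsBetween.symm {u p v : V} (h : T.IsBetween u p v) : T.IsBetween v p u := by
  unfold IsBetween at *
  rw [T.dist_comm (u := v) (v := p), T.dist_comm (u := p) (v := u), T.dist_comm (u := v) (v := u)]
  omega

/-- Two points between the same ends are linearly ordered. -/
lemma IsTree.isBetween_or (hT : T.IsTree) {x y p q : V} (hp : T.IsBetween x p y)
    (hq : T.IsBetween x q y) : T.IsBetween x p q ∨ T.IsBetween x q p := by
  classical
  obtain ⟨P, hP, -⟩ := hT.connected.exists_path_of_dist x y
  have hp' := (hT.mem_support_iff hP).2 hp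
  have hq' := (hT.mem_support_iff hP).2 hq
  rw [← P.take_spec hp', Walk.mem_support_append_iff] at hq'
  rcases hq' with h | h
  · exact Or.inr ((hT.mem_support_iff (hP.takeUntil hp')).1 h)
  · have := (hT.mem_support_iff (hP.dropUntil hp')).1 h
    left
    unfold IsBetween at *
    omega

lemma IsTree.dist_triangle (hT : T.IsTree) (u v w : V) :
    T.dist u w ≤ T.dist u v + T.dist v w :=
  hT.connected.dist_triangle

lemma IsTree.dist_pos (hT : T.IsTree) {u v : V} (h : u ≠ v) : 0 < T.dist u v :=
  hT.connected.pos_dist_of_ne h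

lemma IsTree.eq_of_dist (hT : T.IsTree) {u v : V} (h : T.dist u v = 0) : u = v :=
  hT.connected.dist_eq_zero_iff.1 h

lemma Adj.dist_eq {u v : V} (h : T.Adj u v) : T.dist u v = 1 :=
  dist_eq_one_iff_adj.2 h

lemma isCollinear_left (u v : V) : T.IsCollinear u v u :=
  Or.inl (by simp [IsBetween])

lemma isCollinear_right (u v : V) : T.IsCollinear u v v :=
  Or.inl (by simp [IsBetween])

lemma IsCollinear.swap {u v p : V} (h : T.IsCollinear u v p) : T.IsCollinear v u p := by
  rcases h with h | h | h
  · exact Or.inl h.symm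
  · exact Or.inr (Or.inr h.symm)
  · exact Or.inr (Or.inl h.symm)

lemma isCollinear_swap {u v p : V} : T.IsCollinear u v p ↔ T.IsCollinear v u p :=
  ⟨IsCollinear.swap, IsCollinear.swap⟩

/-- The only path between two points is a shortest one for every weight function, so this is where
the weights disappear. -/
lemma IsTree.isCollinearTriple_iff (hT : T.IsTree) (w : Sym2 V → ℝ) {u v p : V}
    (huv : u ≠ v) (hpu : p ≠ u) (hpv : p ≠ v) :
    T.IsCollinearTriple w {u, v, p} ↔ T.IsCollinear u v p := by
  have key : ∀ x y z : V, (∃ P : T.Walk x z, P.IsShortestPath w ∧ y ∈ P.support) ↔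
      T.IsBetween x y z := by
    intro x y z
    constructor
    · rintro ⟨P, hP, hy⟩
      exact (hT.mem_support_iff hP.1).1 hy
    · intro h
      obtain ⟨P, hP, -⟩ := hT.connected.exists_path_of_dist x z
      refine ⟨P, ⟨hP, fun q hq => ?_⟩, (hT.mem_support_iff hP).2 h⟩
      rw [(hT.existsUnique_path x z).unique hP hq]
  constructor
  · rintro ⟨x, y, z, hs, h⟩
    rw [key] at h
    have hu : u ∈ ({x, y, z} : Set V) := hs ▸ by simp
    have hv : v ∈ ({x, y, z} : Set V) := hs ▸ by simp
    have hp : p ∈ ({x, y, z} : Set V) := hs ▸ by simp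
    simp only [Set.mem_insert_iff, Set.mem_singleton_iff] at hu hv hp
    have h' := h.symm
    unfold IsCollinear
    rcases hu with rfl | rfl | rfl <;> rcases hv with rfl | rfl | rfl <;>
      rcases hp with rfl | rfl | rfl <;> first | contradiction | simp [h, h']
  · rintro (h | h | h)
    · exact ⟨u, p, v, by grind, (key _ _ _).2 h⟩
    · exact ⟨p, u, v, by grind, (key _ _ _).2 h⟩
    · exact ⟨u, v, p, by grind, (key _ _ _).2 h⟩

lemma IsTree.mem_red_line (hT : T.IsTree) (w : Sym2 V → ℝ) {u v p : V} (huv : u ≠ v) :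
    p ∈ (T.derivedSystem w).line Colour.red u v ↔ T.IsCollinear u v p := by
  by_cases hpu : p = u
  · subst hpu
    simp [BicolouredSystem.line, isCollinear_left]
  by_cases hpv : p = v
  · subst hpv
    simp [BicolouredSystem.line, isCollinear_right]
  have hc : ({u, v, p} : Set V).ncard = 3 :=
    Set.ncard_eq_three.2 ⟨u, v, p, huv, Ne.symm hpu, Ne.symm hpv, rfl⟩
  simp [BicolouredSystem.line, derivedSystem, hpu, hpv, hc,
    hT.isCollinearTriple_iff w huv hpu hpv]

lemma IsTree.mem_blue_line (hT : T.IsTree) (w : Sym2 V → ℝ) {u v p : V} (huv : u ≠ v) :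
    p ∈ (T.derivedSystem w).line Colour.blue u v ↔ p = u ∨ p = v ∨ ¬ T.IsCollinear u v p := by
  by_cases hpu : p = u
  · subst hpu
    simp [BicolouredSystem.line]
  by_cases hpv : p = v
  · subst hpv
    simp [BicolouredSystem.line]
  have hc : ({u, v, p} : Set V).ncard = 3 :=
    Set.ncard_eq_three.2 ⟨u, v, p, huv, Ne.symm hpu, Ne.symm hpv, rfl⟩
  simp [BicolouredSystem.line, derivedSystem, hpu, hpv, hc,
    hT.isCollinearTriple_iff w huv hpu hpv]

/-! ### Leaves and the extension of paths to leaves. -/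

/-- Two distinct neighbours of a vertex are at distance two. -/
lemma IsTree.dist_of_adj_of_adj (hT : T.IsTree) {u a b : V} (ha : T.Adj u a) (hb : T.Adj u b)
    (hab : a ≠ b) : T.dist a b = 2 := by
  have h1 := hT.dist_eq_dist_add_one_of_adj b ha
  have h2 := hT.dist_pos hab
  have h3 := hb.dist_eq
  rw [T.dist_comm (u := b) (v := u), T.dist_comm (u := b) (v := a)] at h1
  omega

lemma IsLeafAt.dist_eq {l x u : V} (hl : T.IsLeafAt l x) (hT : T.IsTree) (hu : u ≠ l) :
    T.dist l u = T.dist x u + 1 := by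
  obtain ⟨P, hP, hlen⟩ := hT.connected.exists_path_of_dist l u
  cases P with
  | nil => exact absurd rfl hu
  | cons h q =>
    obtain rfl := hl.2 _ h
    have := hT.length_eq_dist hP.of_cons
    rw [Walk.length_cons] at hlen
    omega

lemma IsLeafAt.dist_eq' {l x u : V} (hl : T.IsLeafAt l x) (hT : T.IsTree) (hu : u ≠ l) :
    T.dist u l = T.dist u x + 1 := by
  rw [T.dist_comm (u := u) (v := l), T.dist_comm (u := u) (v := x)]
  exact hl.dist_eq hT hu

lemma IsLeafAt.eq {l x y : V} (h : T.IsLeafAt l x) (h' : T.IsLeafAt l y) : x = y :=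
  h'.2 _ h.1

/-- A path through `l` would enter and leave by the same neighbour, so the detour to `l` costs two
extra steps. -/
lemma IsLeaf.eq_or_eq_of_isBetween {l u v : V} (hl : T.IsLeaf l) (hT : T.IsTree)
    (h : T.IsBetween u l v) : l = u ∨ l = v := by
  obtain ⟨x, hx⟩ := hl
  by_contra! hne
  have h1 := hx.dist_eq' hT hne.1.symm
  have h2 := hx.dist_eq hT hne.2.symm
  have := hT.dist_triangle u x v
  unfold IsBetween at h
  omega

/-- A vertex other than `z` that is not a leaf has a neighbour further away from `z`. -/
lemma IsTree.exists_isBetween_adj (hT : T.IsTree) {z v : V} (hz : v ≠ z) (hv : ¬ T.IsLeaf v) :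
    ∃ t, T.Adj v t ∧ T.dist z t = T.dist z v + 1 := by
  obtain ⟨P, hP, hlen⟩ := hT.connected.exists_path_of_dist v z
  cases P with
  | nil => exact absurd rfl hz
  | @cons _ y _ h q =>
    have hq := hT.length_eq_dist hP.of_cons
    rw [Walk.length_cons] at hlen
    have : ∃ t, T.Adj v t ∧ t ≠ y := by
      by_contra! hc
      exact hv ⟨y, h, hc⟩
    obtain ⟨t, ht, hty⟩ := this
    refine ⟨t, ht, (hT.dist_eq_dist_add_one_of_adj z ht).resolve_left fun hd => ?_⟩
    have e1 := T.dist_comm (u := z) (v := v)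
    have e2 := T.dist_comm (u := z) (v := t)
    have e3 := hT.dist_of_adj_of_adj ht h hty
    have e4 := ht.dist_eq
    have e5 := h.dist_eq
    -- If `t` were nearer to `z`, then `t` and `y` would both be the first point after `v` on the
    -- way to `z`, although they are at distance two.
    have b1 : T.IsBetween v t z := by unfold IsBetween; omega
    have b2 : T.IsBetween v y z := by unfold IsBetween; omega
    have e6 := T.dist_comm (u := t) (v := y)
    rcases hT.isBetween_or b1 b2 with b | b <;> unfold IsBetween at b <;> omega

/-- Every path starting at `z` extends to a leaf. -/
lemma IsTree.exists_leaf_isBetween [Finite V] (hT : T.IsTree) {z v : V} (hz : v ≠ z) :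
    ∃ l, T.IsLeaf l ∧ l ≠ z ∧ T.IsBetween z v l := by
  classical
  have := Fintype.ofFinite V
  obtain ⟨l, hl, hmax⟩ := Finset.exists_max_image (Finset.univ.filter fun l => T.IsBetween z v l)
    (fun l => T.dist z l) ⟨v, Finset.mem_filter.2 ⟨Finset.mem_univ _, by simp [IsBetween]⟩⟩
  simp only [Finset.mem_filter, Finset.mem_univ, true_and] at hl hmax
  have hlz : l ≠ z := by
    rintro rfl
    have := hT.dist_pos hz
    unfold IsBetween at hl
    rw [dist_self] at hl
    omega
  refine ⟨l, ?_, hlz, hl⟩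
  by_contra hnl
  obtain ⟨t, ht, hd⟩ := hT.exists_isBetween_adj hlz hnl
  have : T.IsBetween z v t := by
    have h1 := hT.dist_triangle v l t
    have h2 := hT.dist_triangle z v t
    have h3 := ht.dist_eq
    unfold IsBetween at *
    omega
  have := hmax t this
  omega

/-! ### Lines expressed through the metric. -/

/-- The blue line of two points, described through the graph metric. -/
def blueSet (T : SimpleGraph V) (u v : V) : Set V :=
  {p | p = u ∨ p = v ∨ ¬ T.IsCollinear u v p}

/-- The red line of two points, described through the graph metric. -/
def redSet (T : SimpleGraph V) (u v : V) : Set V :=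
  {p | T.IsCollinear u v p}

lemma IsTree.red_line_eq (hT : T.IsTree) (w : Sym2 V → ℝ) {u v : V} (huv : u ≠ v) :
    (T.derivedSystem w).line Colour.red u v = T.redSet u v :=
  Set.ext fun _ => hT.mem_red_line w huv

lemma IsTree.blue_line_eq (hT : T.IsTree) (w : Sym2 V → ℝ) {u v : V} (huv : u ≠ v) :
    (T.derivedSystem w).line Colour.blue u v = T.blueSet u v :=
  Set.ext fun _ => hT.mem_blue_line w huv

lemma redSet_comm (u v : V) : T.redSet u v = T.redSet v u :=
  Set.ext fun _ => isCollinear_swap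

lemma blueSet_comm (u v : V) : T.blueSet u v = T.blueSet v u := by
  ext p
  simp only [blueSet, Set.mem_ofPred_eq, isCollinear_swap (u := u) (v := v)]
  tauto

/-- The distances from `v` to the two ends of an edge differ by exactly one. -/
lemma IsTree.isCollinear_of_adj (hT : T.IsTree) {u t : V} (h : T.Adj u t) (v : V) :
    T.IsCollinear u v t := by
  have h1 := hT.dist_eq_dist_add_one_of_adj v h
  have h2 := h.dist_eq
  have h3 := T.dist_comm (u := v) (v := u)
  have h4 := T.dist_comm (u := v) (v := t)
  have h5 := T.dist_comm (u := u) (v := t)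
  unfold IsCollinear IsBetween
  omega

lemma IsTree.isCollinear_of_adj_ends (hT : T.IsTree) {u v : V} (h : T.Adj u v) (p : V) :
    T.IsCollinear u v p := by
  have h1 := hT.dist_eq_dist_add_one_of_adj p h
  have h2 := h.dist_eq
  have h3 := T.dist_comm (u := p) (v := u)
  have h4 := T.dist_comm (u := p) (v := v)
  unfold IsCollinear IsBetween
  omega

/-! ### Coincidences among blue lines. -/

/-- If a point `u` that is not collinear with `a`, `b` has a neighbour `t` on the red line of
`a`, `b`, then `t` lies between `a` and `b`. -/
lemma IsTree.isBetween_of_adj_of_not_isCollinear (hT : T.IsTree) {a b u t : V} (hut : T.Adj u t)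
    (hu : ¬ T.IsCollinear a b u) (ht : T.IsCollinear a b t) : T.IsBetween a t b := by
  have key : ∀ a b : V, ¬ T.IsCollinear a b u → ¬ T.IsBetween t a b := by
    intro a b hu h
    have h1 := hT.dist_eq_dist_add_one_of_adj b hut
    have h2 := hT.dist_eq_dist_add_one_of_adj a hut
    have e1 := T.dist_comm (u := b) (v := u)
    have e2 := T.dist_comm (u := b) (v := t)
    have e3 := T.dist_comm (u := a) (v := u)
    have e4 := T.dist_comm (u := a) (v := t)
    have e5 := T.dist_comm (u := u) (v := t)
    have e6 := hut.dist_eq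
    have tr := hT.dist_triangle u a b
    unfold IsCollinear IsBetween at hu
    have h' := h
    unfold IsBetween at h
    -- Passing from `t` to `u` changes each distance by one. As `u` is not collinear with `a`, `b`,
    -- it must be farther from `a` and nearer to `b`. Then `a` and `u` both lie between `t` and `b`,
    -- and neither order is possible.
    have hb : T.IsBetween t u b := by unfold IsBetween; omega
    rcases hT.isBetween_or h' hb with h3 | h3 <;> unfold IsBetween at h3 <;> omega
  rcases ht with h | h | h
  · exact h
  · exact absurd h (key a b hu)
  · exact absurd h.symm (key b a fun h' => hu h'.swap)

/-- If two blue lines agree, a generator of the first that does not generate the second is a leaf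
attached strictly between the generators of the second. -/
lemma IsTree.exists_leafAt_of_blueSet_eq (hT : T.IsTree) {u v a b : V} (huv : u ≠ v)
    (h : T.blueSet u v = T.blueSet a b) (hua : u ≠ a) (hub : u ≠ b) :
    ∃ x, T.IsLeafAt u x ∧ T.IsBetween a x b ∧ x ≠ a ∧ x ≠ b := by
  have hmem : ∀ p, (p = u ∨ p = v ∨ ¬ T.IsCollinear u v p) ↔
      (p = a ∨ p = b ∨ ¬ T.IsCollinear a b p) := fun p => Set.ext_iff.1 h p
  have hu : ¬ T.IsCollinear a b u := by
    have := (hmem u).1 (Or.inl rfl)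
    tauto
  have hab : a ≠ b := by
    rintro rfl
    refine hu (Or.inr (Or.inl ?_))
    simp [IsBetween]
  have hadj : ¬ T.Adj u v := by
    intro huv'
    have ha := (hmem a).2 (Or.inl rfl)
    have hb := (hmem b).2 (Or.inr (Or.inl rfl))
    have := hT.isCollinear_of_adj_ends huv' a
    have := hT.isCollinear_of_adj_ends huv' b
    grind
  -- A neighbour of `u` is collinear with `u`, `v` and differs from both, so it is not on the common
  -- blue line and is therefore collinear with `a`, `b`.
  have hnb : ∀ t, T.Adj u t → T.IsBetween a t b ∧ t ≠ a ∧ t ≠ b := by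
    intro t ht
    have hta : t ≠ a := by
      rintro rfl
      exact hu (hT.isCollinear_of_adj ht.symm b)
    have htb : t ≠ b := by
      rintro rfl
      exact hu (hT.isCollinear_of_adj ht.symm a).swap
    refine ⟨hT.isBetween_of_adj_of_not_isCollinear ht hu ?_, hta, htb⟩
    by_contra hc
    have h1 := (hmem t).2 (Or.inr (Or.inr hc))
    have h2 := hT.isCollinear_of_adj ht v
    have h3 : t ≠ v := by
      rintro rfl
      exact hadj ht
    have h4 := ht.ne
    tauto
  obtain ⟨P, hP, hlen⟩ := hT.connected.exists_path_of_dist u v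
  cases P with
  | nil => exact absurd rfl huv
  | @cons _ x _ hx q =>
    refine ⟨x, ⟨hx, fun y hy => ?_⟩, hnb x hx⟩
    -- Two neighbours of `u` between `a` and `b`, at distance two from each other, would put `u`
    -- itself between `a` and `b`.
    by_contra hne
    obtain ⟨bx, -⟩ := hnb x hx
    obtain ⟨hxy, -⟩ := hnb y hy
    have d2 := hT.dist_of_adj_of_adj hy hx hne
    have d2' := T.dist_comm (u := x) (v := y)
    have t1 := hT.dist_triangle a x u
    have t2 := hT.dist_triangle a y u
    have t3 := hT.dist_triangle u x b
    have t4 := hT.dist_triangle u y b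
    have t5 := hT.dist_triangle a u b
    have e1 := hx.dist_eq
    have e2 := hy.dist_eq
    have e3 := T.dist_comm (u := u) (v := x)
    have e4 := T.dist_comm (u := u) (v := y)
    unfold IsCollinear IsBetween at hu
    rcases hT.isBetween_or bx hxy with h3 | h3 <;> unfold IsBetween at h3 bx hxy <;> omega

/-- Equal, or leaves with the same neighbour. -/
def IsTwin (T : SimpleGraph V) (u v : V) : Prop :=
  u = v ∨ ∃ x, T.IsLeafAt u x ∧ T.IsLeafAt v x

/-- Twins form equivalence classes. -/
def twinSetoid (T : SimpleGraph V) : Setoid V where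
  r := T.IsTwin
  iseqv := by
    refine ⟨fun u => Or.inl rfl, ?_, ?_⟩
    · rintro u v (h | ⟨x, h, h'⟩)
      · exact Or.inl h.symm
      · exact Or.inr ⟨x, h', h⟩
    · rintro u v w (rfl | ⟨x, h, h'⟩) (rfl | ⟨y, k, k'⟩)
      · exact Or.inl rfl
      · exact Or.inr ⟨y, k, k'⟩
      · exact Or.inr ⟨x, h, h'⟩
      · obtain rfl := h'.eq k
        exact Or.inr ⟨x, h, k'⟩

/-- Blue lines agree only if their generators agree up to twins. -/
lemma IsTree.isTwin_of_blueSet_eq (hT : T.IsTree) {u v a b : V} (huv : u ≠ v) (hab : a ≠ b)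
    (h : T.blueSet u v = T.blueSet a b) :
    (T.IsTwin u a ∧ T.IsTwin v b) ∨ (T.IsTwin u b ∧ T.IsTwin v a) := by
  have shared : ∀ u a v : V, u ≠ v → a ≠ v → u ≠ a → T.blueSet u v = T.blueSet a v →
      T.IsTwin u a := by
    intro u a v huv hav hua h
    obtain ⟨x, hx, bx, hxa, -⟩ := hT.exists_leafAt_of_blueSet_eq huv h hua huv
    obtain ⟨y, hy, hb, hyu, -⟩ := hT.exists_leafAt_of_blueSet_eq hav h.symm hua.symm hav
    refine Or.inr ⟨x, hx, ?_⟩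
    have e1 := hx.dist_eq hT huv.symm
    have e2 := hy.dist_eq hT hav.symm
    have e3 := hx.dist_eq hT hyu
    have e4 := hy.dist_eq hT hxa
    have e5 := T.dist_comm (u := x) (v := y)
    unfold IsBetween at bx hb
    obtain rfl := hT.eq_of_dist (u := x) (v := y) (by omega)
    exact hy
  have refl : ∀ x, T.IsTwin x x := fun x => Or.inl rfl
  by_cases hua : u = a
  · subst hua
    left
    refine ⟨refl _, ?_⟩
    by_cases hvb : v = b
    · exact Or.inl hvb
    · rw [blueSet_comm u v, blueSet_comm u b] at h
      exact shared v b u huv.symm hab.symm hvb h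
  by_cases hub : u = b
  · subst hub
    right
    refine ⟨refl _, ?_⟩
    by_cases hva : v = a
    · exact Or.inl hva
    · rw [blueSet_comm u v] at h
      exact shared v a u huv.symm hab hva h
  by_cases hva : v = a
  · subst hva
    right
    refine ⟨?_, refl _⟩
    rw [blueSet_comm v b] at h
    exact shared u b v huv hab.symm hub h
  by_cases hvb : v = b
  · subst hvb
    exact Or.inl ⟨shared u a v huv hab hua h, refl _⟩
  obtain ⟨x, hx, bx, hxa, hxb⟩ := hT.exists_leafAt_of_blueSet_eq huv h hua hub
  obtain ⟨y, hy, hby, hya, hyb⟩ :=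
    hT.exists_leafAt_of_blueSet_eq huv.symm ((blueSet_comm v u).trans h) hva hvb
  obtain ⟨r, hr, hbr, hru, hrv⟩ :=
    hT.exists_leafAt_of_blueSet_eq hab h.symm (Ne.symm hua) (Ne.symm hva)
  obtain ⟨s, hs, hbs, hsu, hsv⟩ :=
    hT.exists_leafAt_of_blueSet_eq hab.symm ((blueSet_comm b a).trans h.symm)
      (Ne.symm hub) (Ne.symm hvb)
  -- All four generators are now distinct leaves, attached to `x`, `y`, `r`, `s`. Cutting the leaves
  -- off the ends of a path preserves betweenness of inner points, so `x`, `y` lie between `r` and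
  -- `s` and vice versa. This forces the two pairs of neighbours to coincide.
  have inner : ∀ {l m x y p : V}, l ≠ m → T.IsLeafAt l x → T.IsLeafAt m y → p ≠ l → p ≠ m →
      y ≠ l → T.IsBetween l p m → T.IsBetween x p y := by
    intro l m x y p hlm hl hm hpl hpm hyl hb
    have e1 := hl.dist_eq hT hpl
    have e2 := hm.dist_eq' hT hpm
    have e3 := hm.dist_eq' hT hlm
    have e4 := hl.dist_eq hT hyl
    unfold IsBetween at *
    omega
  have sv : ∀ {l m x y p : V}, T.IsBetween l p m → p ≠ l → p ≠ m → T.IsLeafAt l x →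
      T.IsLeafAt m y → l ≠ m → y ≠ l := by
    rintro l m x y p hb hpl hpm hl hm hlm rfl
    have e1 := hm.1.dist_eq
    have e2 := hT.dist_pos hpl
    have e3 := hT.dist_pos hpm
    have e4 := T.dist_comm (u := m) (v := y)
    have e5 := T.dist_comm (u := p) (v := y)
    unfold IsBetween at hb
    omega
  have yu := sv hbr hru hrv hx hy huv
  have sa := sv bx hxa hxb hr hs hab
  have b1 : T.IsBetween r x s := inner hab hr hs hxa hxb sa bx
  have b2 : T.IsBetween r y s := inner hab hr hs hya hyb sa hby
  have b3 : T.IsBetween x r y := inner huv hx hy hru hrv yu hbr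
  have b4 : T.IsBetween x s y := inner huv hx hy hsu hsv yu hbs
  have c1 := T.dist_comm (u := r) (v := x)
  have c2 := T.dist_comm (u := s) (v := y)
  have c3 := T.dist_comm (u := r) (v := y)
  have c4 := T.dist_comm (u := s) (v := x)
  have c5 := T.dist_comm (u := r) (v := s)
  rcases hT.isBetween_or b3 b4 with b | b
  · unfold IsBetween at *
    obtain rfl := hT.eq_of_dist (u := x) (v := r) (by omega)
    obtain rfl := hT.eq_of_dist (u := y) (v := s) (by omega)
    exact Or.inl ⟨Or.inr ⟨x, hx, hr⟩, Or.inr ⟨y, hy, hs⟩⟩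
  · unfold IsBetween at *
    obtain rfl := hT.eq_of_dist (u := x) (v := s) (by omega)
    obtain rfl := hT.eq_of_dist (u := y) (v := r) (by omega)
    exact Or.inr ⟨Or.inr ⟨x, hx, hs⟩, Or.inr ⟨y, hy, hr⟩⟩

/-- Replacing a generator of a blue line by a twin does not change the line, unless the other
generator is the common neighbour. -/
lemma IsTree.blueSet_eq_of_leafAt (hT : T.IsTree) {u a v x : V} (hu : T.IsLeafAt u x)
    (ha : T.IsLeafAt a x) (huv : u ≠ v) (hav : a ≠ v) (hvx : v ≠ x) :
    T.blueSet u v = T.blueSet a v := by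
  by_cases hua : u = a
  · rw [hua]
  have hsub : ∀ u a : V, T.IsLeafAt u x → T.IsLeafAt a x → u ≠ v → a ≠ v → u ≠ a →
      T.blueSet u v ⊆ T.blueSet a v := by
    intro u a hu ha huv hav hua p hp
    have d1 := hu.dist_eq hT huv.symm
    have d2 := ha.dist_eq hT hav.symm
    have d3 := hu.dist_eq hT (Ne.symm hua)
    have d4 := ha.1.dist_eq
    have d5 := T.dist_comm (u := a) (v := x)
    have d6 := hT.dist_pos hvx
    have d7 := T.dist_comm (u := v) (v := x)
    have d8 := T.dist_comm (u := a) (v := u)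
    have d9 := T.dist_comm (u := v) (v := u)
    have d10 := T.dist_comm (u := v) (v := a)
    by_cases hpa : p = a
    · exact Or.inl hpa
    by_cases hpv : p = v
    · exact Or.inr (Or.inl hpv)
    refine Or.inr (Or.inr fun hc => ?_)
    rcases hp with rfl | hp | hp
    · unfold IsCollinear IsBetween at hc
      omega
    · exact hpv hp
    · by_cases hpu : p = u
      · subst hpu
        unfold IsCollinear IsBetween at hc
        omega
      have e1 := hu.dist_eq hT hpu
      have e2 := ha.dist_eq hT hpa
      have e3 := T.dist_comm (u := p) (v := u)
      have e4 := T.dist_comm (u := p) (v := a)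
      unfold IsCollinear IsBetween at hc hp
      omega
  exact (hsub u a hu ha huv hav hua).antisymm (hsub a u ha hu hav huv (Ne.symm hua))

/-- The blue line of two twins misses only their common neighbour. -/
lemma IsTree.blueSet_of_leafAt (hT : T.IsTree) {u v x : V} (hu : T.IsLeafAt u x)
    (hv : T.IsLeafAt v x) (huv : u ≠ v) : T.blueSet u v = {x}ᶜ := by
  ext p
  simp only [blueSet, Set.mem_ofPred_eq, Set.mem_compl_iff, Set.mem_singleton_iff]
  have d1 := hu.dist_eq hT huv.symm
  have d2 := hv.1.dist_eq
  have d3 := T.dist_comm (u := v) (v := x)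
  have d4 := hu.1.dist_eq
  constructor
  · rintro (rfl | rfl | h)
    · exact hu.1.ne
    · exact hv.1.ne
    · rintro rfl
      refine h (Or.inl ?_)
      unfold IsBetween
      omega
  · intro hp
    by_cases hpu : p = u
    · exact Or.inl hpu
    by_cases hpv : p = v
    · exact Or.inr (Or.inl hpv)
    refine Or.inr (Or.inr fun hc => ?_)
    have d5 := hu.dist_eq hT hpu
    have d6 := hv.dist_eq hT hpv
    have d7 := hT.dist_pos hp
    have d8 := T.dist_comm (u := p) (v := u)
    have d9 := T.dist_comm (u := p) (v := v)
    have d10 := T.dist_comm (u := p) (v := x)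
    unfold IsCollinear IsBetween at hc
    omega

/-! ### Twin classes and the exact number of blue lines. -/

/-- A representative of the twin class of a vertex. -/
noncomputable def twinRep (T : SimpleGraph V) (v : V) : V :=
  (Quotient.mk T.twinSetoid v).out

lemma isTwin_twinRep (v : V) : T.IsTwin (T.twinRep v) v :=
  Quotient.exact (s := T.twinSetoid) (Quotient.out_eq _)

lemma twinRep_eq_iff {u v : V} : T.twinRep u = T.twinRep v ↔ T.IsTwin u v := by
  constructor
  · intro h
    exact T.twinSetoid.trans (T.twinSetoid.symm (isTwin_twinRep u)) (h ▸ isTwin_twinRep v)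
  · intro h
    exact congrArg Quotient.out (Quotient.sound (s := T.twinSetoid) h)

@[simp] lemma twinRep_twinRep (v : V) : T.twinRep (T.twinRep v) = T.twinRep v :=
  twinRep_eq_iff.2 (isTwin_twinRep v)

lemma exists_leafAt_of_twinRep_ne {v : V} (h : T.twinRep v ≠ v) :
    ∃ x, T.IsLeafAt v x ∧ T.IsLeafAt (T.twinRep v) x := by
  rcases isTwin_twinRep (T := T) v with h' | ⟨x, h1, h2⟩
  · exact absurd h' h
  · exact ⟨x, h2, h1⟩

open Classical in
/-- The neighbour of a leaf. -/
noncomputable def stem (T : SimpleGraph V) (l : V) : V :=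
  if h : T.IsLeaf l then h.choose else l

lemma IsLeafAt.stem_eq {l x : V} (h : T.IsLeafAt l x) : T.stem l = x := by
  have hl : T.IsLeaf l := ⟨x, h⟩
  rw [stem, dif_pos hl]
  exact hl.choose_spec.eq h

/-- The blue line of an unordered pair. -/
def blueSym (T : SimpleGraph V) : Sym2 V → Set V :=
  Sym2.lift ⟨T.blueSet, blueSet_comm⟩

/-- The red line of an unordered pair. -/
def redSym (T : SimpleGraph V) : Sym2 V → Set V :=
  Sym2.lift ⟨T.redSet, redSet_comm⟩

lemma IsTree.mem_blue_lines (hT : T.IsTree) (w : Sym2 V → ℝ) {L : Set V} :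
    L ∈ (T.derivedSystem w).lines Colour.blue ↔ ∃ u v, u ≠ v ∧ L = T.blueSet u v := by
  constructor
  · rintro ⟨u, v, h, rfl⟩
    exact ⟨u, v, h, hT.blue_line_eq w h⟩
  · rintro ⟨u, v, h, rfl⟩
    exact ⟨u, v, h, (hT.blue_line_eq w h).symm⟩

lemma IsTree.mem_red_lines (hT : T.IsTree) (w : Sym2 V → ℝ) {L : Set V} :
    L ∈ (T.derivedSystem w).lines Colour.red ↔ ∃ u v, u ≠ v ∧ L = T.redSet u v := by
  constructor
  · rintro ⟨u, v, h, rfl⟩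
    exact ⟨u, v, h, hT.red_line_eq w h⟩
  · rintro ⟨u, v, h, rfl⟩
    exact ⟨u, v, h, (hT.red_line_eq w h).symm⟩

lemma IsTree.blueSet_of_adj (hT : T.IsTree) {u v : V} (h : T.Adj u v) :
    T.blueSet u v = {u, v} := by
  ext p
  have := hT.isCollinear_of_adj_ends h p
  simp [blueSet, this]

lemma IsTree.redSet_of_adj (hT : T.IsTree) {u v : V} (h : T.Adj u v) :
    T.redSet u v = Set.univ :=
  Set.eq_univ_of_forall fun p => hT.isCollinear_of_adj_ends h p

lemma IsTree.sym2_twinRep_eq (hT : T.IsTree) {u v a b : V} (huv : u ≠ v) (hab : a ≠ b)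
    (h : T.blueSet u v = T.blueSet a b) :
    s(T.twinRep u, T.twinRep v) = s(T.twinRep a, T.twinRep b) := by
  rw [Sym2.eq_iff]
  simp only [twinRep_eq_iff]
  exact hT.isTwin_of_blueSet_eq huv hab h

/-- Away from common neighbours, generators of blue lines may be replaced by representatives. -/
lemma IsTree.blueSet_twinRep (hT : T.IsTree) {u v : V} (h : T.twinRep u ≠ T.twinRep v)
    (hu : T.twinRep u ≠ u → ¬ T.IsLeafAt u v) (hv : T.twinRep v ≠ v → ¬ T.IsLeafAt v u) :
    T.blueSet u v = T.blueSet (T.twinRep u) (T.twinRep v) := by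
  have step : ∀ {u v : V}, T.twinRep u ≠ T.twinRep v → (T.twinRep u ≠ u → ¬ T.IsLeafAt u v) →
      T.blueSet u v = T.blueSet (T.twinRep u) v := by
    intro u v h hu
    by_cases hr : T.twinRep u = u
    · rw [hr]
    obtain ⟨x, h1, h2⟩ := exists_leafAt_of_twinRep_ne hr
    refine hT.blueSet_eq_of_leafAt h1 h2 ?_ ?_ ?_
    · rintro rfl
      exact h rfl
    · intro h'
      rw [← h', twinRep_twinRep] at h
      exact h rfl
    · rintro rfl
      exact hu hr h1
  rw [step h hu, blueSet_comm, step (u := v), blueSet_comm]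
  · simpa using h.symm
  · intro hr hl
    by_cases hr' : T.twinRep u = u
    · rw [hr'] at hl
      exact hv hr hl
    obtain ⟨x, h1, h2⟩ := exists_leafAt_of_twinRep_ne hr'
    obtain rfl := h2.2 _ hl.1.symm
    exact hu hr' h1

open Classical in
/-- The leaves of a finite graph. -/
noncomputable def leafFinset (T : SimpleGraph V) [Fintype V] : Finset V :=
  Finset.univ.filter T.IsLeaf

open Classical in
/-- The chosen representatives of the twin classes. -/
noncomputable def repFinset (T : SimpleGraph V) [Fintype V] : Finset V :=
  Finset.univ.filter fun v => T.twinRep v = v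

open Classical in
/-- The vertices that do not represent their twin class. -/
noncomputable def nonrepFinset (T : SimpleGraph V) [Fintype V] : Finset V :=
  Finset.univ.filter fun v => T.twinRep v ≠ v

open Classical in
/-- The representatives of twin classes with at least two members. -/
noncomputable def twinnedRepFinset (T : SimpleGraph V) [Fintype V] : Finset V :=
  T.nonrepFinset.image T.twinRep

section Fintype

variable [Fintype V]

lemma mem_leafFinset {l : V} : l ∈ T.leafFinset ↔ T.IsLeaf l := by
  simp [leafFinset]

lemma mem_repFinset {l : V} : l ∈ T.repFinset ↔ T.twinRep l = l := by
  simp [repFinset]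

lemma mem_nonrepFinset {l : V} : l ∈ T.nonrepFinset ↔ T.twinRep l ≠ l := by
  simp [nonrepFinset]

lemma mem_twinnedRepFinset {l : V} :
    l ∈ T.twinnedRepFinset ↔ ∃ u, T.twinRep u ≠ u ∧ T.twinRep u = l := by
  simp [twinnedRepFinset, mem_nonrepFinset]

lemma card_rep_add_card_nonrep :
    T.repFinset.card + T.nonrepFinset.card = Fintype.card V := by
  classical
  simpa [repFinset, nonrepFinset] using
    Finset.card_filter_add_card_filter_not (s := Finset.univ) (fun v => T.twinRep v = v)

lemma disjoint_nonrep_twinnedRep : Disjoint T.nonrepFinset T.twinnedRepFinset := by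
  rw [Finset.disjoint_left]
  intro v h1 h2
  obtain ⟨u, -, rfl⟩ := mem_twinnedRepFinset.1 h2
  exact mem_nonrepFinset.1 h1 (twinRep_twinRep u)

open Classical in
/-- The leaves with a twin are the non-representatives and their representatives. -/
lemma mem_nonrep_union_twinnedRep {v : V} :
    v ∈ T.nonrepFinset ∪ T.twinnedRepFinset ↔
      ∃ u x, u ≠ v ∧ T.IsLeafAt u x ∧ T.IsLeafAt v x := by
  rw [Finset.mem_union, mem_nonrepFinset, mem_twinnedRepFinset]
  constructor
  · rintro (h | ⟨u, h, rfl⟩)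
    · obtain ⟨x, h1, h2⟩ := exists_leafAt_of_twinRep_ne h
      exact ⟨_, x, h, h2, h1⟩
    · obtain ⟨x, h1, h2⟩ := exists_leafAt_of_twinRep_ne h
      exact ⟨_, x, Ne.symm h, h1, h2⟩
  · rintro ⟨u, x, huv, hu, hv⟩
    have h : T.twinRep u = T.twinRep v := twinRep_eq_iff.2 (Or.inr ⟨x, hu, hv⟩)
    by_cases hv' : T.twinRep v = v
    · exact Or.inr ⟨u, by rw [h, hv']; exact huv.symm, h.trans hv'⟩
    · exact Or.inl hv'

/-- Links the blue count to the red one: the vertices counted on the left are the leaves that have a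
twin. -/
lemma card_nonrep_add_card_twinnedRep_le :
    T.nonrepFinset.card + T.twinnedRepFinset.card ≤ T.leafFinset.card := by
  classical
  rw [← Finset.card_union_of_disjoint disjoint_nonrep_twinnedRep]
  apply Finset.card_le_card
  intro v hv
  obtain ⟨u, x, -, -, h⟩ := mem_nonrep_union_twinnedRep.1 hv
  exact mem_leafFinset.2 ⟨x, h⟩

lemma card_twinnedRep_le : T.twinnedRepFinset.card ≤ T.nonrepFinset.card := by
  classical
  exact Finset.card_image_le

/-- The number of blue lines in terms of twin classes. -/
theorem IsTree.ncard_blue_lines (hT : T.IsTree) (w : Sym2 V → ℝ) :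
    ((T.derivedSystem w).lines Colour.blue).ncard =
      T.repFinset.card.choose 2 + T.nonrepFinset.card + T.twinnedRepFinset.card := by
  classical
  -- The three families are the lines of two representatives, the edges at non-representative
  -- leaves, and the lines of two twins, one per nontrivial class.
  set F1 : Finset (Set V) :=
    (T.repFinset.offDiag.image fun q => s(q.1, q.2)).image T.blueSym with hF1
  set F2 : Finset (Set V) := T.nonrepFinset.image fun l => ({l, T.stem l} : Set V) with hF2
  set F3 : Finset (Set V) := T.twinnedRepFinset.image fun l => ({T.stem l}ᶜ : Set V) with hF3
  have m1 : ∀ L, L ∈ F1 ↔ ∃ u v, T.twinRep u = u ∧ T.twinRep v = v ∧ u ≠ v ∧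
      L = T.blueSet u v := by
    intro L
    simp only [hF1, Finset.mem_image, Finset.mem_offDiag, mem_repFinset]
    constructor
    · rintro ⟨_, ⟨⟨u, v⟩, ⟨h1, h2, h3⟩, rfl⟩, rfl⟩
      exact ⟨u, v, h1, h2, h3, rfl⟩
    · rintro ⟨u, v, h1, h2, h3, rfl⟩
      exact ⟨_, ⟨⟨u, v⟩, ⟨h1, h2, h3⟩, rfl⟩, rfl⟩
  have m2 : ∀ L, L ∈ F2 → ∃ l x, T.twinRep l ≠ l ∧ T.IsLeafAt l x ∧ L = {l, x} ∧
      L = T.blueSet l x := by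
    intro L hL
    obtain ⟨l, hl, rfl⟩ := Finset.mem_image.1 hL
    rw [mem_nonrepFinset] at hl
    obtain ⟨x, h1, h2⟩ := exists_leafAt_of_twinRep_ne hl
    refine ⟨l, x, hl, h1, ?_, ?_⟩
    · simp only [h1.stem_eq]
    · simp only [h1.stem_eq, hT.blueSet_of_adj h1.1]
  have m3 : ∀ L, L ∈ F3 → ∃ u x, T.twinRep u ≠ u ∧ T.IsLeafAt u x ∧ T.IsLeafAt (T.twinRep u) x ∧
      L = {x}ᶜ ∧ L = T.blueSet u (T.twinRep u) := by
    intro L hL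
    obtain ⟨l, hl, rfl⟩ := Finset.mem_image.1 hL
    obtain ⟨u, hu, rfl⟩ := mem_twinnedRepFinset.1 hl
    obtain ⟨x, h1, h2⟩ := exists_leafAt_of_twinRep_ne hu
    refine ⟨u, x, hu, h1, h2, ?_, ?_⟩
    · simp only [h2.stem_eq]
    · simp only [h2.stem_eq]
      exact (hT.blueSet_of_leafAt h1 h2 hu.symm).symm
  -- The neighbour of a leaf with a twin has at least two neighbours.
  have nonleaf : ∀ {l x}, T.twinRep l ≠ l → T.IsLeafAt l x → ∀ y, ¬ T.IsLeafAt x y := by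
    intro l x hl hx y hy
    obtain ⟨x', h1, h2⟩ := exists_leafAt_of_twinRep_ne hl
    obtain rfl := hx.eq h1
    exact hl ((hy.2 _ h2.1.symm).trans (hy.2 _ hx.1.symm).symm)
  have hset : (T.derivedSystem w).lines Colour.blue = ↑(F1 ∪ F2 ∪ F3) := by
    ext L
    rw [hT.mem_blue_lines w, Finset.mem_coe, Finset.mem_union, Finset.mem_union]
    constructor
    · rintro ⟨u, v, huv, rfl⟩
      by_cases hr : T.twinRep u = T.twinRep v
      · right
        rcases twinRep_eq_iff.1 hr with h | ⟨x, h1, h2⟩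
        · exact absurd h huv
        refine Finset.mem_image.2 ⟨T.twinRep u, mem_twinnedRepFinset.2 ?_, ?_⟩
        · by_cases hu : T.twinRep u = u
          · exact ⟨v, by rw [← hr, hu]; exact huv, hr.symm⟩
          · exact ⟨u, hu, rfl⟩
        · have : T.stem (T.twinRep u) = x := by
            by_cases hu : T.twinRep u = u
            · rw [hu, h1.stem_eq]
            · obtain ⟨y, h3, h4⟩ := exists_leafAt_of_twinRep_ne hu
              rw [h4.stem_eq, h3.eq h1]
          rw [this, hT.blueSet_of_leafAt h1 h2 huv]
      left
      by_cases hu : T.twinRep u ≠ u ∧ T.IsLeafAt u v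
      · right
        refine Finset.mem_image.2 ⟨u, mem_nonrepFinset.2 hu.1, ?_⟩
        rw [hu.2.stem_eq, hT.blueSet_of_adj hu.2.1]
      by_cases hv : T.twinRep v ≠ v ∧ T.IsLeafAt v u
      · right
        refine Finset.mem_image.2 ⟨v, mem_nonrepFinset.2 hv.1, ?_⟩
        rw [hv.2.stem_eq, blueSet_comm, hT.blueSet_of_adj hv.2.1]
      left
      exact (m1 _).2 ⟨_, _, twinRep_twinRep u, twinRep_twinRep v, hr,
        hT.blueSet_twinRep hr (fun h h' => hu ⟨h, h'⟩) (fun h h' => hv ⟨h, h'⟩)⟩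
    · rintro ((h | h) | h)
      · obtain ⟨u, v, -, -, h3, h4⟩ := (m1 L).1 h
        exact ⟨u, v, h3, h4⟩
      · obtain ⟨l, x, -, h2, -, h4⟩ := m2 L h
        exact ⟨l, x, h2.1.ne, h4⟩
      · obtain ⟨u, x, h1, -, -, -, h4⟩ := m3 L h
        exact ⟨u, _, Ne.symm h1, h4⟩
  have d12 : Disjoint F1 F2 := by
    rw [Finset.disjoint_left]
    intro L h1 h2
    obtain ⟨u, v, hu, hv, huv, rfl⟩ := (m1 L).1 h1
    obtain ⟨l, x, hl, -, h3, -⟩ := m2 _ h2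
    have e1 : u ∈ T.blueSet u v := Or.inl rfl
    have e2 : v ∈ T.blueSet u v := Or.inr (Or.inl rfl)
    rw [h3] at e1 e2
    simp only [Set.mem_insert_iff, Set.mem_singleton_iff] at e1 e2
    rcases e1 with rfl | rfl
    · exact hl hu
    · rcases e2 with rfl | rfl
      · exact hl hv
      · exact huv rfl
  -- Generators of a line in `F3` are twins, those used for `F1` and `F2` are not, and equal blue
  -- lines have the same pair of twin classes.
  have d3 : Disjoint (F1 ∪ F2) F3 := by
    rw [Finset.disjoint_left]
    intro L h1 h2
    obtain ⟨u, x, hu, -, -, -, h3⟩ := m3 L h2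
    have : ∃ a b, T.twinRep a ≠ T.twinRep b ∧ L = T.blueSet a b := by
      rcases Finset.mem_union.1 h1 with h | h
      · obtain ⟨a, b, ha, hb, hab, hL⟩ := (m1 L).1 h
        exact ⟨a, b, by rw [ha, hb]; exact hab, hL⟩
      · obtain ⟨l, y, hl, hy, -, hL⟩ := m2 L h
        refine ⟨l, y, fun he => ?_, hL⟩
        rcases twinRep_eq_iff.1 he with rfl | ⟨z, -, hz⟩
        · exact hy.1.ne rfl
        · exact nonleaf hl hy z hz
    obtain ⟨a, b, hab, hL⟩ := this
    have := hT.sym2_twinRep_eq (u := a) (v := b) (a := u) (b := T.twinRep u)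
      (fun h => hab (by rw [h])) (Ne.symm hu) (hL.symm.trans h3)
    rw [twinRep_twinRep, Sym2.eq_iff] at this
    rcases this with ⟨h, h'⟩ | ⟨h, h'⟩ <;> exact hab (h.trans h'.symm)
  have c1 : F1.card = T.repFinset.card.choose 2 := by
    refine (Finset.card_image_of_injOn ?_).trans (Sym2.card_image_offDiag _)
    intro e he e' he' h
    obtain ⟨⟨u, v⟩, h1, rfl⟩ := Finset.mem_image.1 he
    obtain ⟨⟨a, b⟩, h2, rfl⟩ := Finset.mem_image.1 he'
    simp only [Finset.mem_offDiag, mem_repFinset] at h1 h2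
    have := hT.sym2_twinRep_eq h1.2.2 h2.2.2 h
    rwa [h1.1, h1.2.1, h2.1, h2.2.1] at this
  have c2 : F2.card = T.nonrepFinset.card := by
    rw [hF2, Finset.card_image_of_injOn]
    intro l hl m hm h
    have hl := mem_nonrepFinset.1 hl
    have hm := mem_nonrepFinset.1 hm
    obtain ⟨x, h1, -⟩ := exists_leafAt_of_twinRep_ne hl
    obtain ⟨y, h2, -⟩ := exists_leafAt_of_twinRep_ne hm
    simp only [h1.stem_eq, h2.stem_eq] at h
    have : l ∈ ({m, y} : Set V) := h ▸ Or.inl rfl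
    rcases this with h3 | h3
    · exact h3
    · rw [Set.mem_singleton_iff] at h3
      subst h3
      exact absurd h1 (nonleaf hm h2 x)
  have c3 : F3.card = T.twinnedRepFinset.card := by
    rw [hF3, Finset.card_image_of_injOn]
    intro l hl m hm h
    obtain ⟨u, hu, rfl⟩ := mem_twinnedRepFinset.1 hl
    obtain ⟨v, hv, rfl⟩ := mem_twinnedRepFinset.1 hm
    obtain ⟨x, h1, h1'⟩ := exists_leafAt_of_twinRep_ne hu
    obtain ⟨y, h2, h2'⟩ := exists_leafAt_of_twinRep_ne hv
    simp only [h1'.stem_eq, h2'.stem_eq, compl_inj_iff, Set.singleton_eq_singleton_iff] at h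
    subst h
    exact twinRep_eq_iff.2 (Or.inr ⟨x, h1, h2⟩)
  rw [hset, Set.ncard_coe_finset, Finset.card_union_of_disjoint d3,
    Finset.card_union_of_disjoint d12, c1, c2, c3]

/-! ### A lower bound for the number of red lines. -/

/-- Pairs of leaves generate distinct red lines. -/
theorem IsTree.le_ncard_red_lines (hT : T.IsTree) (w : Sym2 V → ℝ) (h3 : 3 ≤ T.leafFinset.card) :
    T.leafFinset.card.choose 2 + 1 ≤ ((T.derivedSystem w).lines Colour.red).ncard := by
  classical
  set F : Finset (Set V) := (T.leafFinset.offDiag.image fun q => s(q.1, q.2)).image T.redSym with hF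
  -- No leaf lies strictly between two points, so the red line of two leaves contains no third leaf
  -- and its generators can be read off.
  have key : ∀ {u v p}, T.IsLeaf u → T.IsLeaf v → T.IsLeaf p → u ≠ v → T.IsCollinear u v p →
      p = u ∨ p = v := by
    intro u v p hu hv hp huv h
    rcases h with h | h | h
    · exact hp.eq_or_eq_of_isBetween hT h
    · exact Or.inl ((hu.eq_or_eq_of_isBetween hT h).resolve_right huv).symm
    · exact Or.inr ((hv.eq_or_eq_of_isBetween hT h).resolve_left huv.symm).symm
  have c : F.card = T.leafFinset.card.choose 2 := by
    refine (Finset.card_image_of_injOn ?_).trans (Sym2.card_image_offDiag _)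
    intro e he e' he' h
    obtain ⟨⟨u, v⟩, h1, rfl⟩ := Finset.mem_image.1 he
    obtain ⟨⟨a, b⟩, h2, rfl⟩ := Finset.mem_image.1 he'
    simp only [Finset.mem_offDiag, mem_leafFinset] at h1 h2
    have h : T.redSet u v = T.redSet a b := h
    have ha : a ∈ T.redSet u v := h ▸ isCollinear_left a b
    have hb : b ∈ T.redSet u v := h ▸ isCollinear_right a b
    have ha := key h1.1 h1.2.1 h2.1 h1.2.2 ha
    have hb := key h1.1 h1.2.1 h2.2.1 h1.2.2 hb
    have := h2.2.2
    rw [Sym2.eq_iff]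
    grind
  have hu : Set.univ ∉ F := by
    intro h
    obtain ⟨_, he, h⟩ := Finset.mem_image.1 h
    obtain ⟨⟨u, v⟩, h1, rfl⟩ := Finset.mem_image.1 he
    simp only [Finset.mem_offDiag, mem_leafFinset] at h1
    obtain ⟨p, hp, hne⟩ : ∃ p ∈ T.leafFinset, p ∉ ({u, v} : Finset V) := by
      by_contra! hc
      have := Finset.card_le_card (show T.leafFinset ⊆ {u, v} from hc)
      have := Finset.card_le_two (a := u) (b := v)
      omega
    have hmem : p ∈ T.redSet u v := by
      have h : T.redSet u v = Set.univ := h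
      rw [h]
      trivial
    have := key h1.1 h1.2.1 (mem_leafFinset.1 hp) h1.2.2 hmem
    simp at hne
    tauto
  have hsub : (↑(insert Set.univ F) : Set (Set V)) ⊆ (T.derivedSystem w).lines Colour.red := by
    intro L hL
    rw [hT.mem_red_lines w]
    rcases Finset.mem_insert.1 (Finset.mem_coe.1 hL) with rfl | h
    · obtain ⟨l, hl⟩ := Finset.card_pos.1 (show 0 < T.leafFinset.card by omega)
      obtain ⟨x, hx⟩ := mem_leafFinset.1 hl
      exact ⟨l, x, hx.1.ne, (hT.redSet_of_adj hx.1).symm⟩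
    · obtain ⟨_, he, rfl⟩ := Finset.mem_image.1 h
      obtain ⟨⟨u, v⟩, h1, rfl⟩ := Finset.mem_image.1 he
      exact ⟨u, v, (Finset.mem_offDiag.1 h1).2.2, rfl⟩
  have := Set.ncard_le_ncard hsub (Set.toFinite _)
  rwa [Set.ncard_coe_finset, Finset.card_insert_of_notMem hu, c] at this

end Fintype

/-! ### Trees with at most two leaves are paths. -/

/-- Points between `a` and `b` lie at distance the difference of their distances from `a`. -/
lemma IsTree.dist_of_isBetween (hT : T.IsTree) {a b u v : V} (hu : T.IsBetween a u b)
    (hv : T.IsBetween a v b) :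
    T.dist a u + T.dist u v = T.dist a v ∨ T.dist a v + T.dist u v = T.dist a u := by
  rcases hT.isBetween_or hu hv with h | h
  · exact Or.inl h
  · rw [T.dist_comm (u := u) (v := v)]
    exact Or.inr h

lemma IsTree.isCollinear_of_isBetween (hT : T.IsTree) {a b u v p : V} (hu : T.IsBetween a u b)
    (hv : T.IsBetween a v b) (hp : T.IsBetween a p b) : T.IsCollinear u v p := by
  have h1 := hT.dist_of_isBetween hu hv
  have h2 := hT.dist_of_isBetween hu hp
  have h3 := hT.dist_of_isBetween hv hp
  have e1 := T.dist_comm (u := p) (v := u)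
  have e2 := T.dist_comm (u := p) (v := v)
  unfold IsCollinear IsBetween
  omega

lemma isLeafAt_map_iff {W : Type*} {G : SimpleGraph W} (φ : T ≃g G) {l x : V} :
    G.IsLeafAt (φ l) (φ x) ↔ T.IsLeafAt l x := by
  constructor
  · rintro ⟨h1, h2⟩
    exact ⟨φ.map_adj_iff.1 h1, fun y hy => φ.injective (h2 _ (φ.map_adj_iff.2 hy))⟩
  · rintro ⟨h1, h2⟩
    refine ⟨φ.map_adj_iff.2 h1, fun y hy => ?_⟩
    obtain ⟨y, rfl⟩ := φ.surjective y
    rw [h2 _ (φ.map_adj_iff.1 hy)]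

lemma isLeaf_map_iff {W : Type*} {G : SimpleGraph W} (φ : T ≃g G) {l : V} :
    G.IsLeaf (φ l) ↔ T.IsLeaf l := by
  constructor
  · rintro ⟨x, hx⟩
    obtain ⟨x, rfl⟩ := φ.surjective x
    exact ⟨x, (isLeafAt_map_iff φ).1 hx⟩
  · rintro ⟨x, hx⟩
    exact ⟨φ x, (isLeafAt_map_iff φ).2 hx⟩

lemma val_of_isLeaf_pathGraph {n : ℕ} {i : Fin n} (h : (pathGraph n).IsLeaf i) :
    i.val = 0 ∨ i.val = n - 1 := by
  obtain ⟨x, -, hx⟩ := h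
  by_contra! hc
  have h1 := hx ⟨i.val - 1, by omega⟩ (pathGraph_adj.2 (Or.inr (by simp only; omega)))
  have h2 := hx ⟨i.val + 1, by omega⟩ (pathGraph_adj.2 (Or.inl rfl))
  have := congrArg Fin.val (h1.trans h2.symm)
  simp only at this
  omega

section Fintype

variable [Fintype V]

lemma IsTree.exists_ne_leaves [Nontrivial V] (hT : T.IsTree) :
    ∃ a b, T.IsLeaf a ∧ T.IsLeaf b ∧ a ≠ b := by
  obtain ⟨z, v, hzv⟩ := exists_pair_ne V
  obtain ⟨a, ha, -⟩ := hT.exists_leaf_isBetween hzv.symm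
  obtain ⟨y, hy⟩ := exists_ne a
  obtain ⟨b, hb, hba, -⟩ := hT.exists_leaf_isBetween hy
  exact ⟨a, b, ha, hb, hba.symm⟩

/-- A tree with at most two leaves consists of the points between two vertices. -/
lemma IsTree.exists_forall_isBetween [Nontrivial V] (hT : T.IsTree)
    (h : T.leafFinset.card ≤ 2) : ∃ a b, ∀ v, T.IsBetween a v b := by
  classical
  obtain ⟨a, b, ha, hb, hab⟩ := hT.exists_ne_leaves
  refine ⟨a, b, fun v => ?_⟩
  by_cases hva : v = a
  · simp [IsBetween, hva]
  obtain ⟨l, hl, hla, hbt⟩ := hT.exists_leaf_isBetween hva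
  have hsub : ({a, b} : Finset V) ⊆ T.leafFinset := by
    intro x hx
    rcases Finset.mem_insert.1 hx with rfl | hx
    · exact mem_leafFinset.2 ha
    · rw [Finset.mem_singleton.1 hx]
      exact mem_leafFinset.2 hb
  have heq := Finset.eq_of_subset_of_card_le hsub (by rw [Finset.card_pair hab]; exact h)
  have : l ∈ ({a, b} : Finset V) := heq ▸ mem_leafFinset.2 hl
  simp only [Finset.mem_insert, Finset.mem_singleton, hla, false_or] at this
  exact this ▸ hbt

/-- The number of lines of a tree with at most two leaves. -/
theorem IsTree.numLines_of_card_leaf_le [Nontrivial V] (hT : T.IsTree) (w : Sym2 V → ℝ)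
    (h : T.leafFinset.card ≤ 2) :
    (T.derivedSystem w).numLines = (Fintype.card V).choose 2 + 1 := by
  classical
  obtain ⟨a, b, hab⟩ := hT.exists_forall_isBetween h
  have hcol : ∀ u v p, T.IsCollinear u v p := fun u v p =>
    hT.isCollinear_of_isBetween (hab u) (hab v) (hab p)
  have hred : (T.derivedSystem w).lines Colour.red = {Set.univ} := by
    ext L
    rw [hT.mem_red_lines w, Set.mem_singleton_iff]
    constructor
    · rintro ⟨u, v, -, rfl⟩
      exact Set.eq_univ_of_forall fun p => hcol u v p
    · rintro rfl
      obtain ⟨u, v, huv⟩ := exists_pair_ne V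
      exact ⟨u, v, huv, (Set.eq_univ_of_forall fun p => hcol u v p).symm⟩
  have hset : ∀ u v, T.blueSet u v = {u, v} := by
    intro u v
    ext p
    simp [blueSet, hcol]
  have hblue : (T.derivedSystem w).lines Colour.blue =
      ↑((Finset.univ.offDiag.image (Function.uncurry Sym2.mk)).image T.blueSym) := by
    ext L
    rw [hT.mem_blue_lines w]
    simp only [Finset.coe_image, Set.mem_image, Finset.mem_coe, Finset.mem_offDiag,
      Finset.mem_univ, true_and]
    constructor
    · rintro ⟨u, v, huv, rfl⟩
      exact ⟨_, ⟨(u, v), huv, rfl⟩, rfl⟩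
    · rintro ⟨_, ⟨⟨u, v⟩, huv, rfl⟩, rfl⟩
      exact ⟨u, v, huv, rfl⟩
  have hcard : ((Finset.univ.offDiag.image (Function.uncurry Sym2.mk)).image T.blueSym).card =
      (Fintype.card V).choose 2 := by
    refine (Finset.card_image_of_injOn ?_).trans (Sym2.card_image_offDiag _)
    intro e he e' he' heq
    obtain ⟨⟨u, v⟩, huv, rfl⟩ := Finset.mem_image.1 he
    obtain ⟨⟨x, y⟩, hxy, rfl⟩ := Finset.mem_image.1 he'
    have heq : T.blueSet u v = T.blueSet x y := heq
    rw [hset, hset] at heq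
    exact Sym2.eq_iff.2 (Set.pair_eq_pair_iff.1 heq)
  rw [BicolouredSystem.numLines, hred, hblue, Set.ncard_singleton, Set.ncard_coe_finset, hcard,
    add_comm]

lemma IsPathOn.card_leaf_le {n : ℕ} (h : T.IsPathOn n) : T.leafFinset.card ≤ 2 := by
  classical
  obtain ⟨φ⟩ := h
  have : (T.leafFinset.image fun l => (φ l).val) ⊆ {0, n - 1} := by
    intro i hi
    obtain ⟨l, hl, rfl⟩ := Finset.mem_image.1 hi
    simpa using val_of_isLeaf_pathGraph ((isLeaf_map_iff φ).2 (mem_leafFinset.1 hl))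
  rw [← Finset.card_image_of_injective _ (Fin.val_injective.comp φ.injective)]
  exact (Finset.card_le_card this).trans Finset.card_le_two

lemma IsTree.dist_lt_card (hT : T.IsTree) (u v : V) : T.dist u v < Fintype.card V := by
  obtain ⟨P, hP, hl⟩ := hT.connected.exists_path_of_dist u v
  rw [← hl]
  exact hP.length_lt

lemma IsTree.isPathOn [Nontrivial V] (hT : T.IsTree) (h : T.leafFinset.card ≤ 2) :
    T.IsPathOn (Fintype.card V) := by
  obtain ⟨a, b, hab⟩ := hT.exists_forall_isBetween h
  have hd : ∀ u v, _ := fun u v => hT.dist_of_isBetween (hab u) (hab v)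
  let f : V → Fin (Fintype.card V) := fun v => ⟨T.dist a v, hT.dist_lt_card a v⟩
  -- Points on one path are determined by their distance from its end. Injectivity suffices, as both
  -- sides have the same size.
  have hf : Function.Bijective f := by
    rw [Fintype.bijective_iff_injective_and_card]
    refine ⟨fun u v huv => hT.eq_of_dist ?_, by simp⟩
    have : T.dist a u = T.dist a v := congrArg Fin.val huv
    have := hd u v
    omega
  refine ⟨⟨Equiv.ofBijective f hf, ?_⟩⟩
  intro u v
  have := hd u v
  rw [pathGraph_adj, ← dist_eq_one_iff_adj]
  simp only [Equiv.ofBijective_apply, f]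
  omega

end Fintype

/-! ### Brooms: their red lines and their number of lines. -/

/-- `z` is a leaf, and all other leaves are attached to `x`, but `z` is not. -/
structure IsBroomAt (T : SimpleGraph V) (x z : V) : Prop where
  isLeaf : T.IsLeaf z
  not_leafAt : ¬ T.IsLeafAt z x
  leafAt : ∀ l, T.IsLeaf l → l ≠ z → T.IsLeafAt l x

lemma not_isLeafAt_self (x : V) : ¬ T.IsLeafAt x x := fun h => h.1.ne rfl

/-- The path from `z` through `v` extends to a leaf other than `z`. That leaf hangs on `x`, so the
path reaches `x` just before it ends. Hence all vertices but the leaves at `x` form the handle from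
`x` to `z`. -/
lemma IsBroomAt.isBetween [Finite V] {x z v : V} (h : T.IsBroomAt x z) (hT : T.IsTree)
    (hv : ¬ T.IsLeafAt v x) : T.IsBetween x v z := by
  by_cases hvz : v = z
  · simp [IsBetween, hvz]
  obtain ⟨l, hl, hlz, hb⟩ := hT.exists_leaf_isBetween hvz
  have hlx := h.leafAt l hl hlz
  have hvl : v ≠ l := by
    rintro rfl
    exact hv hlx
  have e1 := hlx.dist_eq' hT hvl
  have e2 := hlx.dist_eq' hT hlz.symm
  apply IsBetween.symm
  unfold IsBetween at *
  omega

/-- Any single leaf at `x` prolongs the handle to a longer path. -/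
lemma IsBroomAt.redSet_of_not_leafAt [Finite V] {x z u v : V} (h : T.IsBroomAt x z)
    (hT : T.IsTree) (hu : ¬ T.IsLeafAt u x) (hv : ¬ T.IsLeafAt v x) :
    T.redSet u v = Set.univ := by
  refine Set.eq_univ_of_forall fun p => ?_
  have bu := h.isBetween hT hu
  have bv := h.isBetween hT hv
  by_cases hp : T.IsLeafAt p x
  · have e1 := hp.dist_eq hT (u := u) (by rintro rfl; exact hu hp)
    have e2 := hp.dist_eq hT (u := v) (by rintro rfl; exact hv hp)
    have e3 := hT.dist_of_isBetween bu bv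
    have e4 := T.dist_comm (u := p) (v := u)
    have e5 := T.dist_comm (u := p) (v := v)
    have e6 := T.dist_comm (u := u) (v := v)
    change T.IsCollinear u v p
    unfold IsCollinear IsBetween
    omega
  · exact hT.isCollinear_of_isBetween bu bv (h.isBetween hT hp)

/-- The point of this form is that the right side does not depend on `v`, so `v` can be replaced by
the leaf `z`. -/
lemma IsBroomAt.redSet_of_leafAt [Finite V] {x z u v : V} (h : T.IsBroomAt x z)
    (hT : T.IsTree) (hu : T.IsLeafAt u x) (hv : ¬ T.IsLeafAt v x) (hvx : v ≠ x) :
    T.redSet u v = {p | p = u ∨ ¬ T.IsLeafAt p x} := by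
  ext p
  change T.IsCollinear u v p ↔ p = u ∨ ¬ T.IsLeafAt p x
  have hvu : v ≠ u := by
    rintro rfl
    exact hv hu
  have e1 := hu.dist_eq hT hvu
  have e0 := hT.dist_pos hvx
  have e0' := T.dist_comm (u := x) (v := v)
  have e0'' := T.dist_comm (u := u) (v := v)
  by_cases hpu : p = u
  · subst hpu
    simp [isCollinear_left]
  by_cases hp : T.IsLeafAt p x
  · have e2 := hp.dist_eq hT (u := v) (by rintro rfl; exact hv hp)
    have e3 := hp.dist_eq hT (u := u) (Ne.symm hpu)
    have e4 := hu.1.dist_eq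
    have e5 := T.dist_comm (u := x) (v := u)
    have e6 := T.dist_comm (u := p) (v := u)
    have e7 := T.dist_comm (u := p) (v := v)
    simp only [hpu, hp, not_true, or_false, iff_false]
    unfold IsCollinear IsBetween
    omega
  · simp only [hp, not_false_eq_true, or_true, iff_true]
    have e2 := hu.dist_eq hT hpu
    have e3 := hT.dist_of_isBetween (h.isBetween hT hv) (h.isBetween hT hp)
    have e4 := T.dist_comm (u := p) (v := u)
    have e5 := T.dist_comm (u := p) (v := v)
    unfold IsCollinear IsBetween
    omega

section Fintype

variable [Fintype V]

/-- All red lines of a broom, except for the set of all points, are generated by leaves. -/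
lemma IsBroomAt.ncard_red_lines_le {x z : V} (h : T.IsBroomAt x z) (hT : T.IsTree)
    (w : Sym2 V → ℝ) :
    ((T.derivedSystem w).lines Colour.red).ncard ≤ T.leafFinset.card.choose 2 + 1 := by
  classical
  set F : Finset (Set V) :=
    (T.leafFinset.offDiag.image (Function.uncurry Sym2.mk)).image T.redSym with hF
  have hmem : ∀ u v, T.IsLeaf u → T.IsLeaf v → u ≠ v → T.redSet u v ∈ F := fun u v hu hv huv =>
    Finset.mem_image.2 ⟨s(u, v), Finset.mem_image.2 ⟨(u, v),
      Finset.mem_offDiag.2 ⟨mem_leafFinset.2 hu, mem_leafFinset.2 hv, huv⟩, rfl⟩, rfl⟩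
  have hmixed : ∀ u v, T.IsLeafAt u x → ¬ T.IsLeafAt v x → T.redSet u v ∈ insert Set.univ F := by
    intro u v hu hv
    by_cases hvx : v = x
    · rw [hvx, hT.redSet_of_adj hu.1]
      exact Finset.mem_insert_self _ _
    have hzx : z ≠ x := by
      rintro rfl
      have hb := h.isBetween hT hv
      have := hT.dist_pos hvx
      unfold IsBetween at hb
      rw [dist_self] at hb
      omega
    rw [h.redSet_of_leafAt hT hu hv hvx, ← h.redSet_of_leafAt hT hu h.not_leafAt hzx]
    refine Finset.mem_insert_of_mem (hmem u z ⟨x, hu⟩ h.isLeaf ?_)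
    rintro rfl
    exact h.not_leafAt hu
  have hsub : (T.derivedSystem w).lines Colour.red ⊆ ↑(insert Set.univ F) := by
    intro L hL
    obtain ⟨u, v, huv, rfl⟩ := (hT.mem_red_lines w).1 hL
    rw [Finset.mem_coe]
    by_cases hu : T.IsLeafAt u x
    · by_cases hv : T.IsLeafAt v x
      · exact Finset.mem_insert_of_mem (hmem u v ⟨x, hu⟩ ⟨x, hv⟩ huv)
      · exact hmixed u v hu hv
    · by_cases hv : T.IsLeafAt v x
      · rw [redSet_comm]
        exact hmixed v u hv hu
      · rw [h.redSet_of_not_leafAt hT hu hv]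
        exact Finset.mem_insert_self _ _
  have h1 := Set.ncard_le_ncard hsub (Set.toFinite _)
  rw [Set.ncard_coe_finset] at h1
  refine h1.trans ((Finset.card_insert_le _ _).trans ?_)
  rw [← Sym2.card_image_offDiag]
  exact Nat.add_le_add_right Finset.card_image_le 1

open Classical in
/-- The leaves attached to a vertex. -/
noncomputable def leavesAt (T : SimpleGraph V) (x : V) : Finset V :=
  Finset.univ.filter fun l => T.IsLeafAt l x

lemma mem_leavesAt {l x : V} : l ∈ T.leavesAt x ↔ T.IsLeafAt l x := by
  simp [leavesAt]

lemma IsBroomAt.card_leaf {x z : V} (h : T.IsBroomAt x z) :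
    T.leafFinset.card = (T.leavesAt x).card + 1 := by
  classical
  have : T.leafFinset = insert z (T.leavesAt x) := by
    ext l
    rw [mem_leafFinset, Finset.mem_insert, mem_leavesAt]
    constructor
    · intro hl
      by_cases hlz : l = z
      · exact Or.inl hlz
      · exact Or.inr (h.leafAt l hl hlz)
    · rintro (rfl | hl)
      · exact h.isLeaf
      · exact ⟨x, hl⟩
  rw [this, Finset.card_insert_of_notMem]
  rw [mem_leavesAt]
  exact h.not_leafAt

open Classical in
lemma IsBroomAt.nonrep_union_twinnedRep {x z : V} (h : T.IsBroomAt x z)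
    (h2 : 2 ≤ (T.leavesAt x).card) :
    T.nonrepFinset ∪ T.twinnedRepFinset = T.leavesAt x := by
  ext l
  rw [mem_nonrep_union_twinnedRep, mem_leavesAt]
  constructor
  · rintro ⟨u, y, hul, hu, hl⟩
    by_cases hlz : l = z
    · subst hlz
      have hux := h.leafAt u ⟨y, hu⟩ hul
      rw [hux.eq hu]
      exact hl
    · exact h.leafAt l ⟨y, hl⟩ hlz
  · intro hl
    obtain ⟨u, hu, hul⟩ := Finset.exists_mem_ne (by omega : 1 < (T.leavesAt x).card) l
    exact ⟨u, x, hul, mem_leavesAt.1 hu, hl⟩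

/-- If all twins are attached to one vertex there is only one nontrivial twin class. -/
lemma card_twinnedRep_eq_one {x : V} (h : ∀ l ∈ T.twinnedRepFinset, T.IsLeafAt l x)
    (hne : T.twinnedRepFinset.Nonempty) : T.twinnedRepFinset.card = 1 := by
  obtain ⟨l, hl⟩ := hne
  refine Finset.card_eq_one.2 ⟨l, Finset.eq_singleton_iff_unique_mem.2 ⟨hl, fun m hm => ?_⟩⟩
  obtain ⟨u, -, rfl⟩ := mem_twinnedRepFinset.1 hl
  obtain ⟨v, -, rfl⟩ := mem_twinnedRepFinset.1 hm
  have := twinRep_eq_iff.2 (Or.inr ⟨x, h _ hm, h _ hl⟩)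
  simpa using this

/-- The number of lines of a broom. -/
theorem IsBroomAt.numLines_eq {x z : V} (h : T.IsBroomAt x z) (hT : T.IsTree)
    (w : Sym2 V → ℝ) (s : ℕ) (hs : (T.leavesAt x).card = s + 1) (hs1 : 1 ≤ s) :
    (T.derivedSystem w).numLines =
      (s + 2).choose 2 + 1 + ((Fintype.card V - s).choose 2 + s + 1) := by
  classical
  have hU := h.nonrep_union_twinnedRep (by omega)
  have hcard := congrArg Finset.card hU
  rw [Finset.card_union_of_disjoint disjoint_nonrep_twinnedRep] at hcard
  have hle := card_twinnedRep_le (T := T)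
  have hne : T.twinnedRepFinset.Nonempty := by
    obtain ⟨l, hl⟩ := Finset.card_pos.1 (show 0 < T.nonrepFinset.card by omega)
    exact ⟨_, Finset.mem_image_of_mem _ hl⟩
  have hk : T.twinnedRepFinset.card = 1 := by
    refine card_twinnedRep_eq_one (x := x) (fun l hl => ?_) hne
    rw [← mem_leavesAt, ← hU]
    exact Finset.mem_union_right _ hl
  have hr := card_rep_add_card_nonrep (T := T)
  have hl := h.card_leaf
  -- For a broom the general lower bound for red lines is attained.
  have hred := le_antisymm (h.ncard_red_lines_le hT w) (hT.le_ncard_red_lines w (by omega))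
  rw [BicolouredSystem.numLines, hred, hT.ncard_blue_lines w, hk,
    show T.leafFinset.card = s + 2 by omega, show T.nonrepFinset.card = s by omega,
    show T.repFinset.card = Fintype.card V - s by omega]

/-! ### Identification of brooms with the graphs `broom p q`. -/

lemma broom_adj_inl_inl {p q : ℕ} (i j : Fin p) : ¬ (broom p q).Adj (Sum.inl i) (Sum.inl j) := by
  simp [broom]

lemma broom_adj_inl_inr {p q : ℕ} (i : Fin p) (j : Fin q) :
    (broom p q).Adj (Sum.inl i) (Sum.inr j) ↔ j.val = 0 := by
  simp [broom]

lemma broom_adj_inr_inr {p q : ℕ} (i j : Fin q) :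
    (broom p q).Adj (Sum.inr i) (Sum.inr j) ↔ i.val + 1 = j.val ∨ j.val + 1 = i.val := by
  simp only [broom, fromRel_adj, ne_eq, Sum.inr.injEq, Fin.ext_iff]
  omega

/-- Leaves at `x` are numbered arbitrarily, and a vertex of the handle is numbered by its distance
from `x`. -/
lemma IsBroomAt.nonempty_iso {x z : V} (h : T.IsBroomAt x z) (hT : T.IsTree) :
    Nonempty (T ≃g broom (T.leavesAt x).card (Fintype.card V - (T.leavesAt x).card)) := by
  classical
  set p := (T.leavesAt x).card with hp
  set q := Fintype.card V - p with hq
  have hb := fun v hv => h.isBetween (v := v) hT hv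
  have hcardA : Fintype.card {v // T.IsLeafAt v x} = p := by
    rw [Fintype.card_subtype, hp, leavesAt]
  have hcardS : Fintype.card {v // ¬ T.IsLeafAt v x} = q := by
    rw [Fintype.card_subtype_compl, hcardA]
  have hlt : ∀ v, ¬ T.IsLeafAt v x → T.dist x v < q := by
    intro v hv
    obtain ⟨P, hP, hl⟩ := hT.connected.exists_path_of_dist x v
    -- The path from `x` to `v` stays in the handle, so its `T.dist x v + 1` vertices number at most
    -- `q`.
    have hsub : P.support.toFinset ⊆ Finset.univ.filter fun v => ¬ T.IsLeafAt v x := by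
      intro y hy
      rw [List.mem_toFinset, hT.mem_support_iff hP] at hy
      refine Finset.mem_filter.2 ⟨Finset.mem_univ _, fun hyx => ?_⟩
      rcases IsLeaf.eq_or_eq_of_isBetween ⟨x, hyx⟩ hT hy with rfl | rfl
      · exact not_isLeafAt_self _ hyx
      · exact hv hyx
    have := Finset.card_le_card hsub
    rw [List.toFinset_card_of_nodup hP.support_nodup, Walk.length_support, hl,
      ← Fintype.card_subtype, hcardS] at this
    omega
  let eA : {v // T.IsLeafAt v x} ≃ Fin p := Fintype.equivFinOfCardEq hcardA
  let g : {v // ¬ T.IsLeafAt v x} → Fin q := fun v => ⟨T.dist x v, hlt v v.2⟩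
  have hg : Function.Bijective g := by
    rw [Fintype.bijective_iff_injective_and_card]
    refine ⟨fun u v huv => Subtype.ext (hT.eq_of_dist ?_), by rw [hcardS, Fintype.card_fin]⟩
    have : T.dist x u = T.dist x v := congrArg Fin.val huv
    have := hT.dist_of_isBetween (hb u u.2) (hb v v.2)
    omega
  let eS : {v // ¬ T.IsLeafAt v x} ≃ Fin q := Equiv.ofBijective g hg
  let e : V ≃ Fin p ⊕ Fin q := (Equiv.sumCompl fun v => T.IsLeafAt v x).symm.trans
    (Equiv.sumCongr eA eS)
  have el : ∀ v (hv : T.IsLeafAt v x), e v = Sum.inl (eA ⟨v, hv⟩) := by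
    intro v hv
    simp [e, Equiv.sumCompl_symm_apply_of_pos (p := fun v => T.IsLeafAt v x) hv]
  have er : ∀ v (hv : ¬ T.IsLeafAt v x), e v = Sum.inr ⟨T.dist x v, hlt v hv⟩ := by
    intro v hv
    simp [e, Equiv.sumCompl_symm_apply_of_neg (p := fun v => T.IsLeafAt v x) hv, eS, g]
  have hmixed : ∀ u v, T.IsLeafAt u x → ¬ T.IsLeafAt v x →
      ((broom p q).Adj (e u) (e v) ↔ T.Adj u v) := by
    intro u v hu hv
    rw [el u hu, er v hv, broom_adj_inl_inr]
    constructor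
    · intro hd
      rw [← hT.eq_of_dist hd]
      exact hu.1
    · intro huv
      change T.dist x v = 0
      rw [hu.2 v huv, dist_self]
  refine ⟨⟨e, ?_⟩⟩
  intro u v
  by_cases hu : T.IsLeafAt u x
  · by_cases hv : T.IsLeafAt v x
    · rw [el u hu, el v hv]
      refine iff_of_false (broom_adj_inl_inl _ _) fun huv => ?_
      rw [hu.2 v huv] at hv
      exact not_isLeafAt_self _ hv
    · exact hmixed u v hu hv
  · by_cases hv : T.IsLeafAt v x
    · rw [adj_comm, hmixed v u hv hu, adj_comm]
    · have := hT.dist_of_isBetween (hb u hu) (hb v hv)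
      rw [er u hu, er v hv, broom_adj_inr_inr, ← dist_eq_one_iff_adj]
      simp only
      omega

lemma isLeafAt_broom_inl {p q : ℕ} (i : Fin p) (hq : 0 < q) :
    (broom p q).IsLeafAt (Sum.inl i) (Sum.inr ⟨0, hq⟩) := by
  refine ⟨(broom_adj_inl_inr _ _).2 rfl, fun y hy => ?_⟩
  rcases y with j | j
  · exact absurd hy (broom_adj_inl_inl _ _)
  · rw [broom_adj_inl_inr] at hy
    exact congrArg Sum.inr (Fin.ext hy)

lemma isLeafAt_broom_last {p q : ℕ} (hq : 2 ≤ q) :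
    (broom p q).IsLeafAt (Sum.inr ⟨q - 1, by omega⟩) (Sum.inr ⟨q - 2, by omega⟩) := by
  refine ⟨(broom_adj_inr_inr _ _).2 (by simp only; omega), fun y hy => ?_⟩
  rcases y with j | j
  · rw [adj_comm, broom_adj_inl_inr] at hy
    simp only at hy
    omega
  · rw [broom_adj_inr_inr] at hy
    have := j.2
    simp only at hy
    exact congrArg Sum.inr (Fin.ext (by simp only; omega))

lemma val_of_isLeaf_broom {p q : ℕ} (hp : 1 ≤ p) {j : Fin q}
    (h : (broom p q).IsLeaf (Sum.inr j)) : j.val = q - 1 := by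
  obtain ⟨x, -, hx⟩ := h
  have := j.2
  by_contra hc
  have h1 := hx (Sum.inr ⟨j.val + 1, by omega⟩) ((broom_adj_inr_inr _ _).2 (Or.inl rfl))
  by_cases hj : j.val = 0
  · have h2 := hx (Sum.inl ⟨0, hp⟩) ((broom_adj_inl_inr _ _).2 hj).symm
    exact absurd (h1.trans h2.symm) (by simp)
  · have h2 := hx (Sum.inr ⟨j.val - 1, by omega⟩)
      ((broom_adj_inr_inr _ _).2 (Or.inr (by simp only; omega)))
    have h3 := congrArg Fin.val (Sum.inr_injective (h1.trans h2.symm))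
    simp only at h3
    omega

/-- With `q = 2` the last vertex of the path would itself be a leaf at `inr 0`; `3 ≤ q` keeps it
apart from the others. -/
lemma exists_isBroomAt_of_iso {p q : ℕ} (hp : 1 ≤ p) (hq : 3 ≤ q) (φ : T ≃g broom p q) :
    ∃ x z, T.IsBroomAt x z ∧ (T.leavesAt x).card = p := by
  classical
  obtain ⟨x, hx⟩ := φ.surjective (Sum.inr ⟨0, by omega⟩)
  obtain ⟨z, hz⟩ := φ.surjective (Sum.inr ⟨q - 1, by omega⟩)
  have hlast := isLeafAt_broom_last (p := p) (show 2 ≤ q by omega)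
  have hinl : ∀ l i, φ l = Sum.inl i → T.IsLeafAt l x := by
    intro l i hl
    rw [← isLeafAt_map_iff φ, hl, hx]
    exact isLeafAt_broom_inl i _
  have hzx : ¬ T.IsLeafAt z x := by
    rw [← isLeafAt_map_iff φ, hz, hx]
    intro h
    have h1 := congrArg Fin.val (Sum.inr_injective (h.eq hlast))
    simp only at h1
    omega
  have hb : T.IsBroomAt x z := by
    refine ⟨?_, hzx, fun l hl hlz => ?_⟩
    · rw [← isLeaf_map_iff φ, hz]
      exact ⟨_, hlast⟩
    · rcases hφ : φ l with i | j
      · exact hinl l i hφ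
      · rw [← isLeaf_map_iff φ, hφ] at hl
        refine absurd (φ.injective ?_) hlz
        rw [hφ, hz]
        exact congrArg Sum.inr (Fin.ext (val_of_isLeaf_broom hp hl))
  refine ⟨x, z, hb, ?_⟩
  have : (T.leavesAt x).image φ = Finset.univ.image Sum.inl := by
    ext y
    simp only [Finset.mem_image, mem_leavesAt, Finset.mem_univ, true_and]
    constructor
    · rintro ⟨l, hl, rfl⟩
      rcases hφ : φ l with i | j
      · exact ⟨i, rfl⟩
      · have hleaf : T.IsLeaf l := ⟨x, hl⟩
        rw [← isLeaf_map_iff φ, hφ] at hleaf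
        refine absurd ((show l = z from φ.injective ?_) ▸ hl) hzx
        rw [hφ, hz]
        exact congrArg Sum.inr (Fin.ext (val_of_isLeaf_broom hp hleaf))
    · rintro ⟨i, rfl⟩
      obtain ⟨l, hl⟩ := φ.surjective (Sum.inl i)
      exact ⟨l, hinl l i hl, hl⟩
  rw [← Finset.card_image_of_injective _ φ.injective, this,
    Finset.card_image_of_injective _ Sum.inl_injective, Finset.card_univ, Fintype.card_fin]

end Fintype

end SimpleGraph

namespace SimpleGraph

variable {V : Type*} {T : SimpleGraph V} [Fintype V]

/-! ### Recognising stars and brooms from the leaf counts. -/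

open Classical in
/-- If there is only one nontrivial twin class, it consists of the leaves at some vertex. -/
lemma exists_nonrep_union_twinnedRep_eq (h : T.twinnedRepFinset.card = 1) :
    ∃ x, T.nonrepFinset ∪ T.twinnedRepFinset = T.leavesAt x := by
  obtain ⟨κ, hκ⟩ := Finset.card_eq_one.1 h
  have hmem : ∀ l, l ∈ T.twinnedRepFinset ↔ l = κ := fun l => by rw [hκ, Finset.mem_singleton]
  obtain ⟨u, hu, rfl⟩ := mem_twinnedRepFinset.1 ((hmem κ).2 rfl)
  obtain ⟨x, -, hx⟩ := exists_leafAt_of_twinRep_ne hu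
  refine ⟨x, Finset.ext fun l => ?_⟩
  rw [mem_leavesAt]
  constructor
  · intro hl
    have hrep : T.twinRep l = T.twinRep u := by
      rcases Finset.mem_union.1 hl with hl | hl
      · exact (hmem _).1 (Finset.mem_image_of_mem _ hl)
      · rw [(hmem l).1 hl, twinRep_twinRep]
    rcases isTwin_twinRep (T := T) l with h' | ⟨y, h1, h2⟩
    · rw [← h', hrep]
      exact hx
    · rw [hrep] at h1
      rw [hx.eq h1]
      exact h2
  · intro hl
    by_cases hlu : T.twinRep u = l
    · exact Finset.mem_union_right _ ((hmem l).2 hlu.symm)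
    · exact mem_nonrep_union_twinnedRep.2 ⟨_, x, hlu, hx, hl⟩

/-- A tree all of whose leaves are attached to the same vertex is a star. -/
lemma IsTree.card_le_of_leafFinset_eq [Nontrivial V] (hT : T.IsTree) {x : V}
    (h : T.leafFinset = T.leavesAt x) : Fintype.card V ≤ T.leafFinset.card + 1 := by
  classical
  obtain ⟨a, -, ha, -, -⟩ := hT.exists_ne_leaves
  have hmem : ∀ l, T.IsLeaf l → T.IsLeafAt l x := fun l hl =>
    mem_leavesAt.1 (h ▸ mem_leafFinset.2 hl)
  have hax := hmem a ha
  have : (Finset.univ : Finset V) ⊆ insert x T.leafFinset := by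
    intro v _
    by_cases hva : v = a
    · rw [hva]
      exact Finset.mem_insert_of_mem (mem_leafFinset.2 ha)
    obtain ⟨l, hl, hla, hb⟩ := hT.exists_leaf_isBetween hva
    by_cases hvl : v = l
    · rw [hvl]
      exact Finset.mem_insert_of_mem (mem_leafFinset.2 hl)
    have hlx := hmem l hl
    have e1 := hax.dist_eq hT hla
    have e2 := hlx.dist_eq' hT hvl
    have e3 := hax.dist_eq hT hva
    have e4 := hlx.1.dist_eq
    have e5 := T.dist_comm (u := l) (v := x)
    unfold IsBetween at hb
    -- Here `v` is strictly between the two leaves `a` and `l` at `x`, and the path joining them has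
    -- only `x` inside.
    rw [hT.eq_of_dist (u := v) (v := x) (by omega)]
    exact Finset.mem_insert_self _ _
  exact (Finset.card_le_card this).trans (Finset.card_insert_le _ _)

/-- The single twin class has one more member than there are non-representatives, so exactly one
leaf lies outside it: the far end `z`. -/
lemma exists_isBroomAt (hk : T.twinnedRepFinset.card = 1)
    (hl : T.leafFinset.card = T.nonrepFinset.card + 2) :
    ∃ x z, T.IsBroomAt x z ∧ (T.leavesAt x).card = T.nonrepFinset.card + 1 := by
  classical
  obtain ⟨x, hx⟩ := exists_nonrep_union_twinnedRep_eq hk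
  have hcard := congrArg Finset.card hx
  rw [Finset.card_union_of_disjoint disjoint_nonrep_twinnedRep, hk] at hcard
  have hsub : T.leavesAt x ⊆ T.leafFinset := fun l hl =>
    mem_leafFinset.2 ⟨x, mem_leavesAt.1 hl⟩
  have hdiff : (T.leafFinset \ T.leavesAt x).card = 1 := by
    rw [Finset.card_sdiff_of_subset hsub]
    omega
  obtain ⟨z, hz⟩ := Finset.card_eq_one.1 hdiff
  have hz' : z ∈ T.leafFinset \ T.leavesAt x := by simp [hz]
  rw [Finset.mem_sdiff, mem_leafFinset, mem_leavesAt] at hz'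
  refine ⟨x, z, ⟨hz'.1, hz'.2, fun l hl hlz => ?_⟩, hcard.symm⟩
  by_contra hc
  have : l ∈ T.leafFinset \ T.leavesAt x :=
    Finset.mem_sdiff.2 ⟨mem_leafFinset.2 hl, fun h => hc (mem_leavesAt.1 h)⟩
  rw [hz, Finset.mem_singleton] at this
  exact hlz this

/-! ### The line count of a broom as a quadratic in the number of leaves. -/

lemma two_mul_choose_two_add (m : ℕ) : 2 * m.choose 2 + m = m * m := by
  induction m with
  | zero => rfl
  | succ m ih =>
    have : (m + 1).choose 2 = m + m.choose 2 := by
      rw [Nat.choose_succ_succ' m 1, Nat.choose_one_right]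
    rw [this]
    linarith

/-- The number of lines of a broom on `n` vertices with `s + 1` leaves at the same end. -/
def broomLines (n s : ℕ) : ℕ :=
  (s + 2).choose 2 + 1 + ((n - s).choose 2 + s + 1)

/-- Completing the square in `s` isolates the dependence on the shape of the broom. -/
lemma four_mul_broomLines {n s : ℕ} (h : s ≤ n) :
    (4 * broomLines n s : ℤ) = n ^ 2 + 4 * n + 3 + (n - 2 * s - 3) ^ 2 := by
  obtain ⟨r, rfl⟩ := Nat.exists_eq_add_of_le h
  have h1 := two_mul_choose_two_add (s + 2)
  have h2 := two_mul_choose_two_add r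
  rw [broomLines, show s + r - s = r by omega]
  zify at h1 h2
  push_cast
  linarith

/-! ### The lower bound for trees that are not paths. -/

/-- A tree that is not a path has more lines than a path, or at least as many as a broom, with
equality only for the broom. -/
theorem IsTree.numLines_of_not_isPathOn [Nontrivial V] (hT : T.IsTree) (w : Sym2 V → ℝ)
    (h : ¬ T.IsPathOn (Fintype.card V)) :
    (Fintype.card V).choose 2 + 1 < (T.derivedSystem w).numLines ∨
    ∃ s ≤ Fintype.card V, broomLines (Fintype.card V) s ≤ (T.derivedSystem w).numLines ∧
      ((T.derivedSystem w).numLines = broomLines (Fintype.card V) s →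
        Nonempty (T ≃g broom (s + 1) (Fintype.card V - (s + 1)))) := by
  classical
  have hl3 : 3 ≤ T.leafFinset.card := by
    by_contra hc
    exact h (hT.isPathOn (by omega))
  have hred := hT.le_ncard_red_lines w hl3
  have hblue := hT.ncard_blue_lines w
  have hn := card_rep_add_card_nonrep (T := T)
  have hsk := card_nonrep_add_card_twinnedRep_le (T := T)
  have hks := card_twinnedRep_le (T := T)
  have hln : T.leafFinset.card ≤ Fintype.card V := Finset.card_le_univ _
  rw [BicolouredSystem.numLines, hblue]
  rcases lt_trichotomy T.twinnedRepFinset.card 1 with hk | hk | hk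
  -- Without twins the blue lines already number C(n, 2), and three leaves give at least four red
  -- ones.
  · left
    have hN : T.nonrepFinset.card = 0 := by
      rw [Finset.card_eq_zero]
      by_contra hne
      obtain ⟨l, hl⟩ := Finset.nonempty_iff_ne_empty.2 hne
      have := Finset.card_pos.2 ⟨_, Finset.mem_image_of_mem T.twinRep hl⟩
      unfold twinnedRepFinset at hk
      omega
    have := Nat.choose_le_choose 2 hl3
    have h32 : Nat.choose 3 2 = 3 := rfl
    rw [show T.repFinset.card = Fintype.card V by omega]
    omega
  · by_cases hl : T.leafFinset.card = T.nonrepFinset.card + 1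
    -- All leaves are twins, so there is at most one further vertex. The lower bound for such a star
    -- beats a path by one line.
    · left
      obtain ⟨x, hx⟩ := exists_nonrep_union_twinnedRep_eq hk
      have hcard := congrArg Finset.card hx
      rw [Finset.card_union_of_disjoint disjoint_nonrep_twinnedRep, hk] at hcard
      have heq : T.leavesAt x = T.leafFinset := Finset.eq_of_subset_of_card_le
        (fun l hl => mem_leafFinset.2 ⟨x, mem_leavesAt.1 hl⟩) (by omega)
      have hle := hT.card_le_of_leafFinset_eq heq.symm
      have c1 := two_mul_choose_two_add (Fintype.card V)
      have c2 := two_mul_choose_two_add T.leafFinset.card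
      have c3 := two_mul_choose_two_add T.repFinset.card
      rw [hl] at c2 hred
      rw [← hn] at c1 ⊢
      obtain hr | hr : T.repFinset.card = 1 ∨ T.repFinset.card = 2 := by omega
      · rw [hr] at c1 c3 ⊢
        rw [add_comm 1] at c1 ⊢
        omega
      · rw [hr] at c1 c3 ⊢
        have : (2 + T.nonrepFinset.card) * (2 + T.nonrepFinset.card) =
            (T.nonrepFinset.card + 1) * (T.nonrepFinset.card + 1) +
              2 * T.nonrepFinset.card + 3 := by
          ring
        omega
    · right
      refine ⟨T.nonrepFinset.card, by omega, ?_, ?_⟩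
      · have := Nat.choose_le_choose 2 (show T.nonrepFinset.card + 2 ≤ T.leafFinset.card by omega)
        rw [broomLines, show Fintype.card V - T.nonrepFinset.card = T.repFinset.card by omega]
        omega
      · intro heq
        rw [broomLines, show Fintype.card V - T.nonrepFinset.card = T.repFinset.card by omega]
          at heq
        -- One more leaf would strictly increase the number of red lines.
        have hle : T.leafFinset.card ≤ T.nonrepFinset.card + 2 := by
          by_contra hc
          have := Nat.choose_le_choose 2
            (show T.nonrepFinset.card + 2 + 1 ≤ T.leafFinset.card by omega)
          rw [Nat.choose_succ_succ' _ 1, Nat.choose_one_right, one_add_one_eq_two] at this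
          omega
        obtain ⟨x, z, hb, hx⟩ := exists_isBroomAt hk (by omega)
        rw [← hx]
        exact hb.nonempty_iso hT
  -- Two nontrivial classes again give two leaves more than non-representatives, and the second
  -- class adds a blue line, so equality cannot occur.
  · right
    have := Nat.choose_le_choose 2 (show T.nonrepFinset.card + 2 ≤ T.leafFinset.card by omega)
    refine ⟨T.nonrepFinset.card, by omega, ?_, ?_⟩ <;>
      rw [broomLines, show Fintype.card V - T.nonrepFinset.card = T.repFinset.card by omega] <;>
      omega

lemma IsPathOn.numLines_eq [Nontrivial V] (h : T.IsPathOn (Fintype.card V)) (hT : T.IsTree)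
    (w : Sym2 V → ℝ) : (T.derivedSystem w).numLines = (Fintype.card V).choose 2 + 1 :=
  hT.numLines_of_card_leaf_le w h.card_leaf_le

lemma numLines_of_iso_broom (hT : T.IsTree) (w : Sym2 V → ℝ) {a : ℕ} (ha : 2 ≤ a)
    (ha' : a + 3 ≤ Fintype.card V) (φ : T ≃g broom a (Fintype.card V - a)) :
    (T.derivedSystem w).numLines = broomLines (Fintype.card V) (a - 1) := by
  obtain ⟨x, z, hb, hx⟩ := exists_isBroomAt_of_iso (by omega) (by omega) φ
  exact hb.numLines_eq hT w (a - 1) (by omega) (by omega)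

lemma floor_sq_div_four_add (n : ℕ) : ⌊(n : ℝ) ^ 2 / 4 + n + 1⌋₊ = n ^ 2 / 4 + n + 1 := by
  have h : (n : ℝ) ^ 2 / 4 + n + 1 = ((n ^ 2 : ℕ) : ℝ) / ((4 : ℕ) : ℝ) + ((n + 1 : ℕ) : ℝ) := by
    push_cast
    ring
  rw [h, Nat.floor_add_natCast (by positivity), Nat.floor_div_natCast, Nat.floor_natCast]
  rfl

/-- The square is nonnegative, and the constant 3 in n² + 4n + 3 is just what rounding up to an
integer needs. -/
lemma sq_div_four_le_broomLines {n s : ℕ} (h : s ≤ n) : n ^ 2 / 4 + n + 1 ≤ broomLines n s := by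
  have h1 := four_mul_broomLines h
  have h2 := sq_nonneg ((n : ℤ) - 2 * s - 3)
  have h3 : ((n ^ 2 : ℕ) : ℤ) = (n : ℤ) ^ 2 := by push_cast; rfl
  rw [← h3] at h1
  omega

lemma sq_mod_four (n : ℕ) : n ^ 2 % 4 = n % 2 := by
  rcases Nat.even_or_odd' n with ⟨c, rfl | rfl⟩
  · rw [show (2 * c) ^ 2 = 4 * c ^ 2 by ring]
    omega
  · rw [show (2 * c + 1) ^ 2 = 4 * (c ^ 2 + c) + 1 by ring]
    omega

/-- The brooms with the fewest lines. -/
lemma broomLines_eq_iff {n s : ℕ} (h : s ≤ n) :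
    broomLines n s = n ^ 2 / 4 + n + 1 ↔
      (Odd n ∧ s + 1 = (n - 1) / 2) ∨ (Even n ∧ 2 ≤ n ∧ (s + 1 = n / 2 - 1 ∨ s + 1 = n / 2)) := by
  have h1 := four_mul_broomLines h
  have h2 := sq_mod_four n
  have h3 : ((n ^ 2 : ℕ) : ℤ) = (n : ℤ) ^ 2 := by push_cast; rfl
  rw [← h3] at h1
  rw [Nat.odd_iff, Nat.even_iff]
  set d : ℤ := (n : ℤ) - 2 * s - 3 with hd
  constructor
  · intro heq
    -- Equality leaves only d = 0 for odd n and d = ±1 for even n; the two signs give the two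
    -- balanced brooms.
    have h4 : d ^ 2 + (n % 2 : ℕ) = 1 := by
      omega
    rcases Nat.mod_two_eq_zero_or_one n with hm | hm
    · rw [hm] at h4
      have : d = 1 ∨ d = -1 := by
        rw [← sq_eq_one_iff]
        simpa using h4
      omega
    · rw [hm] at h4
      have : d = 0 := by
        rw [← sq_eq_zero_iff]
        simpa using h4
      omega
  · rintro (⟨hm, hs⟩ | ⟨hm, hn, hs⟩)
    · have : d = 0 := by omega
      rw [this] at h1
      omega
    · have : d = 1 ∨ d = -1 := by omega
      have : d ^ 2 = 1 := sq_eq_one_iff.2 this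
      omega

end SimpleGraph

/-! ### Comparison of paths and brooms according to n. -/

theorem mainTheorem1 {V : Type*} [Fintype V] (T : SimpleGraph V) (hT : T.IsTree)
    (w : Sym2 V → ℝ) (hw : ∀ e ∈ T.edgeSet, 0 < w e)
    (n : ℕ) (hn : Fintype.card V = n) (hn3 : 3 ≤ n) :
    (6 ≤ n →
      ⌊(n : ℝ) ^ 2 / 4 + n + 1⌋₊ ≤ (T.derivedSystem w).numLines ∧
      ((T.derivedSystem w).numLines = ⌊(n : ℝ) ^ 2 / 4 + n + 1⌋₊ ↔
        (n ≤ 6 ∧ T.IsPathOn n) ∨ (6 ≤ n ∧ T.IsBalancedBroom n))) ∧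
    (n ≤ 6 →
      n.choose 2 + 1 ≤ (T.derivedSystem w).numLines ∧
      ((T.derivedSystem w).numLines = n.choose 2 + 1 ↔
        (n ≤ 6 ∧ T.IsPathOn n) ∨ (6 ≤ n ∧ T.IsBalancedBroom n))) := by
  subst hn
  have : Nontrivial V := Fintype.one_lt_card_iff_nontrivial.1 (by omega)
  rw [SimpleGraph.floor_sq_div_four_add]
  have hnp := hT.numLines_of_not_isPathOn w
  set n := Fintype.card V with hn
  set m := (T.derivedSystem w).numLines with hm
  have hc := SimpleGraph.two_mul_choose_two_add n
  have hsq : n ^ 2 = n * n := sq n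
  have hbroom : 6 ≤ n → T.IsBalancedBroom n → m = n ^ 2 / 4 + n + 1 := by
    rintro h6 ⟨a, ha, ⟨φ⟩⟩
    have ha' := ha
    rw [Nat.odd_iff, Nat.even_iff] at ha'
    rw [hm, SimpleGraph.numLines_of_iso_broom hT w (by omega) (by omega) φ,
      SimpleGraph.broomLines_eq_iff (by omega)]
    rw [show a - 1 + 1 = a by omega]
    exact ha.imp id fun h => ⟨h.1, by omega, h.2⟩
  -- The path bound and the broom bound cross at n = 6: brooms win above, paths below, and both are
  -- extremal at 6.
  have hchoose : 6 < n → n ^ 2 / 4 + n + 1 < n.choose 2 + 1 := by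
    intro h
    have : 7 * n ≤ n * n := Nat.mul_le_mul_right n h
    omega
  have hchoose6 : n = 6 → n ^ 2 / 4 + n + 1 = n.choose 2 + 1 := by
    intro h
    rw [h]
    rfl
  have hchoose5 : n < 6 → n.choose 2 + 1 < n ^ 2 / 4 + n + 1 := by
    intro h
    interval_cases n <;> decide
  by_cases hp : T.IsPathOn n
  · have hmp : m = n.choose 2 + 1 := hp.numLines_eq hT w
    refine ⟨fun h6 => ⟨?_, fun he => Or.inl ⟨?_, hp⟩, ?_⟩,
      fun h6 => ⟨by omega, fun _ => Or.inl ⟨h6, hp⟩, fun _ => hmp⟩⟩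
    · omega
    · omega
    · rintro (⟨h, -⟩ | ⟨h, hb⟩)
      · omega
      · exact hbroom h hb
  · rcases hnp hp with hlt | ⟨s, hs, hle, heq⟩
    · have hnb : 6 ≤ n → ¬ T.IsBalancedBroom n := by
        intro h hb
        have := hbroom h hb
        omega
      refine ⟨fun h6 => ⟨by omega, fun he => by omega, ?_⟩,
        fun h6 => ⟨by omega, fun he => by omega, ?_⟩⟩
      all_goals
        rintro (⟨-, h⟩ | ⟨h, hb⟩)
        · exact absurd h hp
        · exact absurd hb (hnb h)
    · have hlow := SimpleGraph.sq_div_four_le_broomLines hs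
      have hbal : 6 ≤ n → m = n ^ 2 / 4 + n + 1 → T.IsBalancedBroom n := by
        intro h6 he
        have hb : SimpleGraph.broomLines n s = n ^ 2 / 4 + n + 1 := by omega
        refine ⟨s + 1, ?_, heq (by omega)⟩
        exact ((SimpleGraph.broomLines_eq_iff hs).1 hb).imp id fun h => ⟨h.1, h.2.2⟩
      refine ⟨fun h6 => ⟨by omega, fun he => Or.inr ⟨h6, hbal h6 he⟩, ?_⟩,
        fun h6 => ⟨by omega, fun he => ?_, ?_⟩⟩
      · rintro (⟨-, h⟩ | ⟨h, hb⟩)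
        · exact absurd h hp
        · exact hbroom h hb
      -- For n < 6 every broom bound exceeds the count of a path, so equality with the latter leaves
      -- only n = 6.
      · have h6' : n = 6 := by omega
        exact Or.inr ⟨by omega, hbal (by omega) (by omega)⟩
      · rintro (⟨-, h⟩ | ⟨h, hb⟩)
        · exact absurd h hp
        · have := hbroom h hb
          omega
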